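/- \textbf{Leapers and frames.} Squares of the infinite chessboard are identified with integer points. For integers $0<p<q$, a $(p,q)$-leaper moves by the translations $(\pm p,\pm q)$, $(\pm q,\pm p)$; it is skew basic if moreover $p+q$ is odd and $\gcd(p,q)=1$. All boards and frames below are centred at the origin. For $0<m<n$ with $m+n$ odd, the $(m,n)$-frame $F$ is the $(m+n)\times(m+n)$ chessboard without its central $(n-m)\times(n-m)$ hole; the lines extending the sides of the hole cut it into eight rectangular sections $F_{E},F_{NE},F_{N},\dots,F_{SE}$. Its shell is empty if $3m<n$; otherwise it is the union of eight squares of side $\min(n-m,3m-n)$ centred at $(\pm(n-m),0)$, $(0,\pm(n-m))$, $(\pm m,\pm m)$. A shell cycle of $F$ is a cycle of the $(m,n)$-leaper within the shell. \textbf{Liftings.} $f$, $g$, $h$ lift an $(m,n)$-frame $F$ to an $(m,2m+n)$-, $(n,2n-m)$-, $(n,m+2n)$-frame $H$ respectively. With $u_i\in\{-1,0,1\}^2\setminus\{0\}$ the vector pointing in direction $i\in\{E,NE,\dots,SE\}$, put $v_i=a\,u_i$ for $i\in\{E,N,W,S\}$ and $v_i=b\,u_i$ for the other four $i$, where $(a,b)=(m+n,m)$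 for $f$, $(n-m,n)$ for $g$, $(m+n,n)$ for $h$. A set $S$ of squares of $F$ is lifted to $\bigcup_i (S+v_i)\cap H_i$. A cycle $a^{E}a^{NE}\cdots a^{SE}$ which is the concatenation of eight disjoint nonempty paths $a^i$ within the sections $F_i$ is \emph{proper} if, for each $i$, the $(m,n)$-leaper translation that maps $F_i\cup F_{i+1}$ onto $F_{-(i+1)}\cup F_{-i}$ maps the path $a^ia^{i+1}$ onto $-a^{-(i+1)}{-a^{-i}}$; here $i+1$ is the next direction counterclockwise, $-i$ the opposite one, and $-w$ the reversed path. Such a cycle is lifted to $b^{E}b^{NE}\cdots b^{SE}$, where, up to quarter-turn symmetry, for $f$: $b^{E}={-a^{SW}}{-a^{W}}{-a^{NW}}+v_E$ and $b^{NE}=a^{NE}+v_{NE}$; for $g$: $b^{E}=a^{E}+v_E$ and $b^{NE}={-a^{S}}{-a^{SW}}{-a^{W}}+v_{NE}$; for $h$: $b^{E}={-a^{S}}{-a^{SW}}{-a^{W}}{-a^{NW}}{-a^{N}}+v_E$ and $b^{NE}=a^{E}a^{NE}a^{N}+v_{NE}$. To lift by a string $e=e_1e_2\cdots e_l$ over $\{\mathtt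 f,\mathtt g,\mathtt h\}$ is to lift successively by $e_l,e_{l-1},\dots,e_1$. The descent of a skew basic $(p,q)$-leaper is the string that lifts the $(1,2)$-frame to the $(p,q)$-frame. \textbf{Cycles of given descent.} Let $C$ be a cycle of a skew basic $(p,q)$-leaper $L$ within the $(p+q)\times(p+q)$ chessboard. If the descent of $L$ is a concatenation $e\,e^*$ and the square set of $C$ is the lift by $e$ of the square set of a shell cycle $C_0$ of the frame obtained from the $(1,2)$-frame by lifting by $e^*$, then $C$ has descent $e$. Suppose moreover that $e^*=o\,e^{**}$ with $o\in\{\mathtt g,\mathtt h\}$, and let $e^{**}$ be the descent of the $(r,s)$-leaper $M$. Then the lift by $e$ of a proper cycle of $M$ over the squares of $C_0$ is a canonical second leaper cycle over the squares of $C$, of descent $e$ and origin $o$. \textbf{Direction graphs.} Let $A_1,\dots,A_8$ be the matrices $$\begin{pmatrix}0&1\\1&0\end{pmatrix},\begin{pmatrix}1&0\\0&1\end{pmatrix},\begin{pmatrix}-1&0\\0&1\end{pmatrix},\begin{pmatrix}0&-1\\1&0\end{pmatrix},\begin{pmatrix}0&-1\\-1&0\end{pmatrix},\begin{pmatrix}-1&0\\0&-1\end{pmatrix},\begin{pmatrix}1&0\\0&-1\end{pmatrix},\begin{pmatrix}0&1\\-1&0\end{pmatrix}.$$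 A move $v$ of a $(p,q)$-leaper with $0<p<q$ has direction $i\in\{1,\dots,8\}$ if $v^T=A_i\binom pq$. A direction graph is a symmetric directed graph whose arcs are labelled by $1,\dots,8$ so that the matrices $A_i$ of the labels sum to zero over every simple directed cycle (including those of length two). It is extracted from a cycle of a leaper if its vertices correspond one-to-one to the squares of the cycle so that an arc labelled $i$ leads from $x$ to $y$ if and only if a move of direction $i$ of the cycle leads from the square of $x$ to that of $y$. Two direction graphs are equivalent if there are a permutation $\pi$ of $\{1,\dots,8\}$ and real $2\times2$ matrices $P,Q$ with $A_{\pi(i)}=PA_iQ$ for all $i$ such that replacing every label $i$ of the first graph by $\pi(i)$ gives, up to renaming of vertices, the second. The fundamental direction cycle $\Phi(e)$ is the direction graph extracted from a cycle of descent $e$ of a skew basic $(p,q)$-leaper within the $(p+q)\times(p+q)$ chessboard; the second fundamental direction cycle $\Phi^{\mathrm{II}}_o(e)$, $o\in\{\mathtt g,\mathtt h\}$, is the one extracted from a canonical second leaper cycle of descent $e$ and origin $o$. \textbf{Theorem.} The flip of a string $e_1e_2\cdots e_l$ over $\{\mathtt f,\mathtt g,\mathtt h\}$ is $\overline{e_l}\,\overline{e_{l-1}}\cdots\overline{e_1}$,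 where $\overline{\mathtt f}=\mathtt g$, $\overline{\mathtt g}=\mathtt f$, $\overline{\mathtt h}=\mathtt h$. Let the strings $e'$ and $e''$ be flips of each other. Then $\Phi(e')$, $\Phi^{\mathrm{II}}_{\mathtt g}(e'')$ and $\Phi^{\mathrm{II}}_{\mathtt h}(e'')$ exist, and these three direction graphs are pairwise equivalent, whichever cycles of the given descents and origins they are extracted from. -/

import Mathlib

namespace Leaper

/-! ## Squares, leapers, leaper graphs

A square is identified with its centre, an integer point.  All leapers of interest satisfy
`p + q` odd, so the `(p + q) × (p + q)` chessboard can be centred at the square `(0, 0)`. -/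

/-- A unit square of the infinite chessboard, given by its centre. -/
abbrev Square := ℤ × ℤ

/-- `v` is one of the translations `(±p, ±q)`, `(±q, ±p)`. -/
def IsMove (p q : ℤ) (v : Square) : Prop :=
  (|v.1| = p ∧ |v.2| = q) ∨ (|v.1| = q ∧ |v.2| = p)

/-- The leaper graph of the `(p, q)`-leaper over the infinite chessboard. -/
def leaperGraph (p q : ℤ) : SimpleGraph Square where
  Adj a b := a ≠ b ∧ IsMove p q (b - a)
  symm := ⟨by
    rintro a b ⟨h, hm⟩
    refine ⟨h.symm, ?_⟩
    have e : a - b = -(b - a) := by abel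
    rw [e]
    simpa only [IsMove, Prod.fst_neg, Prod.snd_neg, abs_neg] using hm⟩
  loopless := ⟨fun _ h => h.1 rfl⟩

/-- The `(p, q)`-leaper is skew and basic, its proportions being listed in increasing order. -/
structure IsSkewBasic (p q : ℤ) : Prop where
  pos : 0 < p
  lt : p < q
  odd : Odd (p + q)
  coprime : IsCoprime p q

/-- A cycle of the `(p, q)`-leaper, as a subgraph of its leaper graph. -/
def IsCycle {p q : ℤ} (C : (leaperGraph p q).Subgraph) : Prop :=
  ∃ (a : Square) (w : (leaperGraph p q).Walk a a), w.IsCycle ∧ w.toSubgraph = C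

/-- `C` is the cycle that visits the squares of the list `l` in this cyclic order, each once. -/
def IsCycleThrough {p q : ℤ} (l : List Square) (C : (leaperGraph p q).Subgraph) : Prop :=
  ∃ (a : Square) (w : (leaperGraph p q).Walk a a),
    w.IsCycle ∧ w.support.dropLast = l ∧ w.toSubgraph = C

/-! ## Frames, sections, shells

The eight compass directions `E, NE, N, NW, W, SW, S, SE` are `0, 1, …, 7 : Fin 8`, with
cyclic addition; the direction opposite `i` is `i + 4`.  Sides are even, corners are odd.
An `(m, n)`-frame centred at the origin is given by the pair `F = (m, n)`. -/

/-- The sign pattern of a compass direction. -/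
def compass : Fin 8 → Square :=
  ![(1, 0), (1, 1), (0, 1), (-1, 1), (-1, 0), (-1, -1), (0, -1), (1, -1)]

/-- The `(m + n) × (m + n)` chessboard centred at the origin. -/
def board (F : ℤ × ℤ) : Set Square :=
  {s | |2 * s.1| < F.1 + F.2 ∧ |2 * s.2| < F.1 + F.2}

/-- For `c = 0`, the coordinate `x` lies in the central band, of width `n - m`; for `c = ±1`, it
lies in the outer band, of width `m`, on the side of sign `c`. -/
def InBand (F : ℤ × ℤ) (c x : ℤ) : Prop :=
  if c = 0 then |2 * x| < F.2 - F.1 else F.2 - F.1 < 2 * (c * x) ∧ 2 * (c * x) < F.1 + F.2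

/-- The section `F_i` of the frame `F`: the part of the board outside the central hole is cut
into eight rectangles by the lines that extend the sides of the hole. -/
def frameSection (F : ℤ × ℤ) (i : Fin 8) : Set Square :=
  {s | InBand F (compass i).1 s.1 ∧ InBand F (compass i).2 s.2}

/-- The side of the eight square subboards that form the shell: `n - m` if `2m ≥ n`, and
`3m - n` if `2m ≤ n`. -/
def shellSize (F : ℤ × ℤ) : ℤ :=
  if F.2 ≤ 2 * F.1 then F.2 - F.1 else 3 * F.1 - F.2

/-- The shell of the frame `F = (m, n)`: the squares within the eight square subboards of side
`shellSize F` whose centres are `(±(n - m), 0)`, `(0, ±(n - m))` and `(±m, ±m)`.  If `2m ≥ n`,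
these are the subboards of side `n - m` in the four corners of `F` and those adjacent by side to
the hole.  If `2m ≤ n ≤ 3m`, they are the subboards of side `3m - n` in the middles of the outer
sides of `F` and those adjacent by corner to the hole.  (For `3m < n` the set is empty.) -/
def shell (F : ℤ × ℤ) : Set Square :=
  {s | ∃ i : Fin 8,
    let c : ℤ := if i.val % 2 = 0 then F.2 - F.1 else F.1
    |2 * (s.1 - c * (compass i).1)| < shellSize F ∧ |2 * (s.2 - c * (compass i).2)| < shellSize F}

/-- A shell cycle: a cycle of the `(m, n)`-leaper within the shell of the `(m, n)`-frame. -/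
def IsShellCycle (F : ℤ × ℤ) (C : (leaperGraph F.1 F.2).Subgraph) : Prop :=
  IsCycle C ∧ C.verts ⊆ shell F

/-! ## Lifting transformations and descents -/

/-- The three characters `f`, `g`, `h`. -/
inductive Letter
  | f
  | g
  | h

/-- The proportions of the frame to which a lifting transformation lifts an `(m, n)`-frame. -/
def liftFrame : Letter → ℤ × ℤ → ℤ × ℤ
  | .f, F => (F.1, 2 * F.1 + F.2)
  | .g, F => (F.2, 2 * F.2 - F.1)
  | .h, F => (F.2, F.1 + 2 * F.2)

/-- The lengths of the coordinates of the lifting translations in the side (first component) and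
in the corner (second component) directions. -/
def liftLengths : Letter → ℤ × ℤ → ℤ × ℤ
  | .f, F => (F.1 + F.2, F.1)
  | .g, F => (F.2 - F.1, F.2)
  | .h, F => (F.1 + F.2, F.2)

/-- The `f`-, `g`- or `h`-translation that points in direction `i`. -/
def liftVector (t : Letter) (F : ℤ × ℤ) (i : Fin 8) : Square :=
  (if i.val % 2 = 0 then (liftLengths t F).1 else (liftLengths t F).2) • compass i

/-- The lifting transformations on sets of squares of the frame `F`: the union over all
directions `i` of `(S + v_i) ∩ H_i`, where `H` is the larger frame. -/
def liftSet (t : Letter) (F : ℤ × ℤ) (S : Set Square) : Set Square :=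
  ⋃ i : Fin 8, ((fun s => s + liftVector t F i) '' S) ∩ frameSection (liftFrame t F) i

/-- Lift the frame `F` successively by `e_l, …, e_1`, where `e = e_1 … e_l`. -/
def liftFrameSeq (e : List Letter) (F : ℤ × ℤ) : ℤ × ℤ := e.foldr liftFrame F

/-- Lift the set `S` of squares of the frame `F` successively by `e_l, …, e_1`. -/
def liftSetSeq : List Letter → ℤ × ℤ → Set Square → Set Square
  | [], _, S => S
  | t :: e, F, S => liftSet t (liftFrameSeq e F) (liftSetSeq e F S)

/-- `e` is the descent of the `(p, q)`-leaper: it lifts a `(1, 2)`-frame to a `(p, q)`-frame. -/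
def IsLeaperDescent (e : List Letter) (p q : ℤ) : Prop := liftFrameSeq e (1, 2) = (p, q)

/-- `C` is a cycle of the skew basic `(p, q)`-leaper within a `(p + q) × (p + q)` chessboard, the
prefix `e` of the descent `e ++ rest` of the leaper, and `C` is obtained from the shell cycle `C₀`
by successive lifting transformations of types `e_l, …, e_1`. -/
structure IsCycleFromShell (e rest : List Letter) (p q : ℤ) (C : (leaperGraph p q).Subgraph)
    (C₀ : (leaperGraph (liftFrameSeq rest (1, 2)).1 (liftFrameSeq rest (1, 2)).2).Subgraph) :
    Prop where
  skewBasic : IsSkewBasic p q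
  leaperDescent : IsLeaperDescent (e ++ rest) p q
  cycle : IsCycle C
  onBoard : C.verts ⊆ board (p, q)
  shellCycle : IsShellCycle (liftFrameSeq rest (1, 2)) C₀
  lift : C.verts = liftSetSeq e (liftFrameSeq rest (1, 2)) C₀.verts

/-- `C` is a cycle of descent `e` of a skew basic `(p, q)`-leaper within a `(p + q) × (p + q)`
chessboard. -/
def IsCycleOfDescent (e : List Letter) (p q : ℤ) (C : (leaperGraph p q).Subgraph) : Prop :=
  ∃ rest C₀, IsCycleFromShell e rest p q C C₀

/-! ## Proper cycles and canonical second leaper cycles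

A cycle that is the concatenation of eight paths, one in each section of a frame, is given by
the family `a` of these paths, as lists of squares. -/

/-- The concatenation `a^E a^NE … a^SE`. -/
def concatPaths (a : Fin 8 → List Square) : List Square := (List.ofFn a).flatten

/-- The `(m, n)`-leaper translation that maps `F_i ∪ F_{i+1}` onto `F_{-(i+1)} ∪ F_{-i}`. -/
def properVector (F : ℤ × ℤ) : Fin 8 → Square :=
  ![(-F.2, -F.1), (-F.1, -F.2), (F.1, -F.2), (F.2, -F.1),
    (F.2, F.1), (F.1, F.2), (-F.1, F.2), (-F.2, F.1)]

/-- `D = a^E a^NE … a^SE` is a proper cycle of the `(r, s)`-leaper within the frame `F`. -/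
structure IsProperCycle (F : ℤ × ℤ) {r s : ℤ} (a : Fin 8 → List Square)
    (D : (leaperGraph r s).Subgraph) : Prop where
  nonempty : ∀ i, a i ≠ []
  within : ∀ i, ∀ x ∈ a i, x ∈ frameSection F i
  cycle : IsCycleThrough (concatPaths a) D
  proper : ∀ i, (a i ++ a (i + 1)).map (fun x => x + properVector F i) =
    (a (i + 5)).reverse ++ (a (i + 4)).reverse

/-- The paths, before translation by `v_i`, that form the section `b^i` of the lift of the proper
cycle `a^E … a^SE`.  For `f` and `i = E`, this is `-a^SW -a^W -a^NW`; for `f` and `i = NE`, it is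
`a^NE`; for `g` and `i = E`, it is `a^E`; for `g` and `i = NE`, it is `-a^S -a^SW -a^W`; for `h` and
`i = E`, it is `-a^S -a^SW -a^W -a^NW -a^N`; for `h` and `i = NE`, it is `a^E a^NE a^N`.  (In each
case, these are the parts of the cycle whose translates by `v_i` lie in the section `H_i`.) -/
def liftPathsAux (t : Letter) (a : Fin 8 → List Square) (i : Fin 8) : List Square :=
  match t with
  | .f => if i.val % 2 = 0 then (a (i + 3) ++ a (i + 4) ++ a (i + 5)).reverse else a i
  | .g => if i.val % 2 = 0 then a i else (a (i + 3) ++ a (i + 4) ++ a (i + 5)).reverse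
  | .h => if i.val % 2 = 0 then
      (a (i + 2) ++ a (i + 3) ++ a (i + 4) ++ a (i + 5) ++ a (i + 6)).reverse
    else a (i + 7) ++ a i ++ a (i + 1)

/-- The lift of a proper cycle within the frame `F`, as a family of eight paths. -/
def liftPaths (t : Letter) (F : ℤ × ℤ) (a : Fin 8 → List Square) (i : Fin 8) : List Square :=
  (liftPathsAux t a i).map (fun x => x + liftVector t F i)

/-- Lift a proper cycle within the frame `F` successively by `e_l, …, e_1`. -/
def liftPathsSeq : List Letter → ℤ × ℤ → (Fin 8 → List Square) → (Fin 8 → List Square)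
  | [], _, a => a
  | t :: e, F, a => liftPaths t (liftFrameSeq e F) (liftPathsSeq e F a)

/-- `D` is a canonical second leaper cycle, of descent `e` and origin `o`, of a skew basic
`(r, s)`-leaper over the squares of the cycle `C` of a skew basic `(p, q)`-leaper within a
`(p + q) × (p + q)` chessboard.  That is, for some word `rest`: the `(p, q)`-leaper has descent
`e ++ o :: rest`; the word `rest` lifts a `(1, 2)`-frame to an `(r, s)`-frame, which `o` lifts to a
frame `F`; the cycle `C` is the lift by `e` of a cycle `C₀` within the shell of `F`; and `D` is the
lift by `e` of a proper cycle `D₀` of the `(r, s)`-leaper over the squares of `C₀`. -/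
def IsCanonicalSecondCycle (e : List Letter) (o : Letter) {p q r s : ℤ}
    (C : (leaperGraph p q).Subgraph) (D : (leaperGraph r s).Subgraph) : Prop :=
  ∃ rest C₀, IsCycleFromShell e (o :: rest) p q C C₀ ∧
    IsSkewBasic r s ∧ liftFrameSeq rest (1, 2) = (r, s) ∧
    ∃ (a : Fin 8 → List Square) (D₀ : (leaperGraph r s).Subgraph),
      IsProperCycle (liftFrameSeq (o :: rest) (1, 2)) a D₀ ∧ D₀.verts = C₀.verts ∧
      IsCycleThrough (concatPaths (liftPathsSeq e (liftFrameSeq (o :: rest) (1, 2)) a)) D ∧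
      D.verts = C.verts

/-! ## Skew directions and direction graphs

The eight skew directions, labelled `1, …, 8` counterclockwise from east-northeast, are
`0, …, 7 : Fin 8`: the direction labelled `k` is `k - 1`. -/

/-- The direction matrices `A_1, …, A_8`. -/
def dirMatrix : Fin 8 → Matrix (Fin 2) (Fin 2) ℤ :=
  ![!![0, 1; 1, 0], !![1, 0; 0, 1], !![-1, 0; 0, 1], !![0, -1; 1, 0],
    !![0, -1; -1, 0], !![-1, 0; 0, -1], !![1, 0; 0, -1], !![0, 1; -1, 0]]

/-- The translation `v` is the move of direction `i` of the `(p, q)`-leaper, `p < q`: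
`vᵀ = A_i (p, q)ᵀ`. -/
def IsMoveOfDirection (p q : ℤ) (i : Fin 8) (v : Square) : Prop :=
  ![v.1, v.2] = (dirMatrix i).mulVec ![p, q]

/-- A direction graph on the vertex set `V`: `Arc x y i` says that there is an arc from `x` to `y`
labelled `i`.  The graph is symmetric, and the direction matrices sum to zero over every simple
directed cycle, those of length one and two included (so there are no loops, no two arcs
from `x` to `y` have different labels, and opposite arcs have opposite labels). -/
structure DirectionGraph (V : Type*) where
  Arc : V → V → Fin 8 → Prop
  symm : ∀ x y i, Arc x y i → ∃ j, Arc y x j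
  cycle_sum : ∀ (n : ℕ) (x : Fin (n + 1) → V) (l : Fin (n + 1) → Fin 8), Function.Injective x →
    (∀ k, Arc (x k) (x (k + 1)) (l k)) → ∑ k, dirMatrix (l k) = 0

/-- The direction graph `Φ` is extracted from the graph `G` of moves of the `(p, q)`-leaper. -/
def IsExtractedFrom {V : Type*} (Φ : DirectionGraph V) {p q : ℤ}
    (G : (leaperGraph p q).Subgraph) : Prop :=
  ∃ σ : G.verts ≃ V, ∀ (a b : G.verts) (i : Fin 8),
    (G.Adj a b ∧ IsMoveOfDirection p q i ((b : Square) - a)) ↔ Φ.Arc (σ a) (σ b) i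

/-- The permutation `π` of the eight skew directions is an equivalence permutation. -/
def IsEquivalencePerm (π : Equiv.Perm (Fin 8)) : Prop :=
  ∃ P Q : Matrix (Fin 2) (Fin 2) ℝ, ∀ i,
    (dirMatrix (π i)).map (Int.cast : ℤ → ℝ) = P * (dirMatrix i).map (Int.cast : ℤ → ℝ) * Q

/-- `Φ₁` and `Φ₂` are equivalent: relabelling the arcs of `Φ₁` by some equivalence permutation
gives `Φ₂`, up to renaming of the vertices. -/
def DirectionGraph.Equivalent {V W : Type*} (Φ₁ : DirectionGraph V) (Φ₂ : DirectionGraph W) :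
    Prop :=
  ∃ π : Equiv.Perm (Fin 8), IsEquivalencePerm π ∧
    ∃ τ : V ≃ W, ∀ x y i, Φ₁.Arc x y i ↔ Φ₂.Arc (τ x) (τ y) (π i)

/-- `Φ` is the fundamental direction cycle of descent `e`. -/
def IsFundamental {V : Type*} (e : List Letter) (Φ : DirectionGraph V) : Prop :=
  ∃ (p q : ℤ) (C : (leaperGraph p q).Subgraph), IsCycleOfDescent e p q C ∧ IsExtractedFrom Φ C

/-- `Φ` is the second fundamental direction cycle of descent `e` and origin `o`. -/
def IsSecondFundamental {V : Type*} (e : List Letter) (o : Letter) (Φ : DirectionGraph V) : Prop :=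
  ∃ (p q r s : ℤ) (C : (leaperGraph p q).Subgraph) (D : (leaperGraph r s).Subgraph),
    IsCanonicalSecondCycle e o C D ∧ IsExtractedFrom Φ D

/-! ## Flips -/

/-- The involution that swaps `f` and `g` and fixes `h`. -/
def Letter.bar : Letter → Letter
  | .f => .g
  | .g => .f
  | .h => .h

/-- The flip of a string of letters: reverse it and bar every letter. -/
def flip (e : List Letter) : List Letter := (e.map Letter.bar).reverse

end Leaper

namespace Leaper
-- Conjugate cyclically reduced words in free groups
open FreeGroup

/-! A direction graph extracted from a cycle is determined by the cyclic word of directions read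
along the cycle. The theorem therefore reduces to one fact about words: after a fixed relabelling of
directions, `firstWord (flip e)` and `secondWord e` are rotations of each other.

Both words obey recursions. On the first cycle, the two moves available from a square depend only on
its section, and a lifting replaces each square by a list of squares whose types depend only on its
type; lifting is thus a substitution on the sixteen types. On the second cycle, a lifting glues and
reverses eight path words, separated by eight junction labels. Prepending a letter to `e` adds an
outermost gluing to the second word; the flip appends the barred letter at the other end, which adds
an innermost substitution to the first word. One induction on `e` thus follows both words.

The pieces of the two words are not equal, but their values in any group where opposite directions
are inverse remain related by a `Gauge`: corresponding pieces differ by factors that cancel between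
neighbours, while the `cross` relation lets reversed blocks be rewritten in the same form. Hence the
two products are conjugate (`exists_gauge`, `isConj_words`). In the free group with one generator
for each pair of opposite directions, conjugate cyclically reduced words are rotations of each other
(`isRotated_of_isConj`). Both words are cyclically reduced, since a cycle through distinct squares
never undoes its last move (`Follows.noBacktrack`).

The link with geometry rests on rigidity: on the board every square has at most two moves, so a
cycle is determined by any one of its squares (`IsCycle.eq_of_mem`). Shell cycles are therefore
translates of the eight shell centres, and their lifts are the explicit typed cycles. A proper cycle
over a shell cycle has one square in each section, and its lift follows `secondWord` relabelled by
`originDirection`. Existence comes from these explicit cycles; their direction matrices sum to zero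
by central symmetry. Finally, the relabellings are realised by explicit matrices `P`, `Q`. -/

theorem isCyclicallyReduced_cons_iff {α : Type*} {x : α × Bool} {T : List (α × Bool)} :
    IsCyclicallyReduced (x :: T) ↔ IsCyclicallyReduced (T ++ [x]) := by
  have h₁ : IsCyclicallyReduced (x :: T) ↔ FreeGroup.IsReduced ((x :: T) ++ [x]) := by
    unfold IsCyclicallyReduced FreeGroup.IsReduced
    rw [List.isChain_append]
    simp
  have h₂ : IsCyclicallyReduced (T ++ [x]) ↔ FreeGroup.IsReduced (x :: (T ++ [x])) := by
    unfold IsCyclicallyReduced FreeGroup.IsReduced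
    rw [List.isChain_cons]
    simp
    grind
  rw [h₁, h₂, List.cons_append]

/-- Induction on the conjugator. If its last letter `y` cancels against the first or the last letter
of `L₁`, the cancellation amounts to rotating `L₁` by one letter and shortening the conjugator. If
nothing cancels and `L₁` is nonempty, the conjugated word is already reduced, hence equal to `L₂`,
yet its first and last letters are inverse, contrary to cyclic reducedness. -/
theorem isRotated_of_conj {α : Type*} [DecidableEq α]
    {L₂ : List (α × Bool)} (h₂ : IsCyclicallyReduced L₂) (c : List (α × Bool)) :
    ∀ {L₁ : List (α × Bool)}, IsCyclicallyReduced L₁ → FreeGroup.IsReduced c →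
      mk c * mk L₁ * (mk c)⁻¹ = mk L₂ → L₁ ~r L₂ := by
  induction c using List.reverseRecOn with
  | nil =>
    intro L₁ h₁ _ h
    have h' : mk L₁ = mk L₂ := by
      rw [← one_eq_mk] at h
      simpa using h
    have := reduce.sound h'
    rw [h₁.1.reduce_eq, h₂.1.reduce_eq] at this
    rw [this]
  | append_singleton c y ih =>
    intro L₁ h₁ hc h
    have hc' : FreeGroup.IsReduced c := hc.infix ⟨[], [y], by simp⟩
    by_cases hx : ∃ T, L₁ = (y.1, !y.2) :: T
    · obtain ⟨T, rfl⟩ := hx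
      have hinv : mk [(y.1, !y.2)] = (mk [y])⁻¹ := by simp [inv_mk, invRev]
      have e : mk ((y.1, !y.2) :: T) = (mk [y])⁻¹ * mk T := by
        rw [← hinv, mul_mk]; rfl
      have e' : mk (T ++ [(y.1, !y.2)]) = mk T * (mk [y])⁻¹ := by
        rw [← hinv, mul_mk]
      have := ih (isCyclicallyReduced_cons_iff.1 h₁) hc' (by
        rw [← h, e, e', ← mul_mk]; group)
      exact List.IsRotated.trans ⟨1, by simp⟩ this
    · by_cases hz : ∃ T, L₁ = T ++ [y]
      · obtain ⟨T, rfl⟩ := hz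
        have e' : mk (y :: T) = mk [y] * mk T := by rw [mul_mk]; rfl
        have := ih (isCyclicallyReduced_cons_iff.2 h₁) hc' (by
          rw [← h, e', ← mul_mk, ← mul_mk]; group)
        exact List.IsRotated.trans (List.IsRotated.symm ⟨1, by simp⟩) this
      · rcases List.eq_nil_or_concat L₁ with rfl | ⟨S, z, hS⟩
        · have h0 : mk L₂ = mk [] := by
            rw [← h, ← one_eq_mk]; group
          have := reduce.sound h0
          rw [h₂.1.reduce_eq, reduce_nil] at this
          rw [this]
        · exfalso
          rw [List.concat_eq_append] at hS
          have hne : L₁ ≠ [] := by simp [hS]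
          obtain ⟨x, T, hT⟩ := List.exists_cons_of_ne_nil hne
          have hxy : y.1 = x.1 → y.2 = x.2 := by
            intro e
            by_contra hb
            refine hx ⟨T, ?_⟩
            rw [hT, e]
            congr 1
            ext <;> simp
            revert hb
            cases y.2 <;> cases x.2 <;> simp
          have hzy : z.1 = y.1 → z.2 = !y.2 := by
            intro e
            by_contra hb
            refine hz ⟨S, ?_⟩
            rw [hS]
            congr 2
            ext
            · simp [e]
            · revert hb
              cases y.2 <;> cases z.2 <;> simp
          -- Neither junction of the conjugated word cancels: the left one by `hxy`, the right one
          -- by `hzy`.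
          have hr : FreeGroup.IsReduced ((c ++ [y]) ++ (L₁ ++ invRev (c ++ [y]))) := by
            have hinv : FreeGroup.IsReduced (invRev (c ++ [y])) := by
              rw [isReduced_iff_reduce_eq, reduce_invRev, hc.reduce_eq]
            have h₁' := h₁.1
            unfold FreeGroup.IsReduced at hc h₁' hinv ⊢
            refine List.isChain_append.2 ⟨hc, List.isChain_append.2 ⟨h₁', hinv, ?_⟩, ?_⟩
            · rw [hS]
              simpa [invRev] using hzy
            · rw [hT]
              simpa using hxy
          have h3 : mk ((c ++ [y]) ++ (L₁ ++ invRev (c ++ [y]))) = mk L₂ := by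
            rw [← h, inv_mk, mul_mk, mul_mk]
            simp only [List.append_assoc]
          have h4 := reduce.sound h3
          rw [hr.reduce_eq, h₂.1.reduce_eq] at h4
          obtain ⟨d, D, hD⟩ := List.exists_cons_of_ne_nil (show c ++ [y] ≠ [] by simp)
          have := h₂.2
          have h5 : L₂ = d :: (D ++ L₁ ++ invRev D) ++ [(d.1, !d.2)] := by
            rw [← h4, hD]
            simp [invRev]
          rw [h5, List.getLast?_concat] at this
          simp at this

theorem isRotated_of_isConj {α : Type*} [DecidableEq α] {L₁ L₂ : List (α × Bool)}
    (h₁ : IsCyclicallyReduced L₁) (h₂ : IsCyclicallyReduced L₂) (h : IsConj (mk L₁) (mk L₂)) :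
    L₁ ~r L₂ := by
  obtain ⟨c, hc⟩ := isConj_iff.1 h
  refine isRotated_of_conj h₂ c.toWord h₁ isReduced_toWord ?_
  rwa [mk_toWord]

/-! ## Gauge equivalence of eight-periodic words -/

/-- The data `(A, X)` and `(a, x)` of two closed words `A₀ X₀ ⋯ A₇ X₇` and `a₀ x₀ ⋯ a₇ x₇` are
related by the gauge `(g, h)`. -/
structure Gauge {G : Type*} [Group G] (A X a x g h : Fin 8 → G) : Prop where
  antipode₁ : ∀ k, X (k + 4) = (X k)⁻¹
  antipode₂ : ∀ k, x (k + 4) = (x k)⁻¹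
  block : ∀ k, A k = g k * a k * h k
  junction : ∀ k, X k = (h k)⁻¹ * x k * (g (k + 1))⁻¹
  cross : ∀ k, h k * g (k + 3) = (a k)⁻¹ * (a (k + 3))⁻¹

namespace Gauge

variable {G : Type*} [Group G] {A X a x g h : Fin 8 → G}

/-- The `cross` relation solved for an inverse factor: this is how inverting a block trades the
factors at its ends for the gauge of the opposite part of the word. -/
theorem inv_h (H : Gauge A X a x g h) (k : Fin 8) : (h k)⁻¹ = g (k + 3) * a (k + 3) * a k := by
  have := H.cross k
  rw [← mul_inv_rev, ← mul_eq_one_iff_eq_inv] at this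
  rw [inv_eq_iff_mul_eq_one, ← this]
  group

theorem inv_g (H : Gauge A X a x g h) (k : Fin 8) : (g (k + 3))⁻¹ = a (k + 3) * a k * h k := by
  have e : g (k + 3) = (h k)⁻¹ * ((a k)⁻¹ * (a (k + 3))⁻¹) := by
    rw [← H.cross k]; group
  rw [e]
  group

/-- The step for the letters `f` and `g`, depending on the parity class `P`. -/
theorem step_fg (H : Gauge A X a x g h) (P : Fin 8 → Prop) [DecidablePred P]
    (hP : ∀ k, P (k + 1) ↔ ¬ P k) :
    Gauge
      (fun k => if P k then (A (k + 3) * X (k + 3) * A (k + 4) * X (k + 4) * A (k + 5))⁻¹ else A k)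
      X
      (fun k => if P k then (a (k + 4))⁻¹
        else a (k + 7) * x (k + 7) * a k * x k * a (k + 1))
      (fun k => if P k then x (k + 7) else x (k + 1))
      (fun k => if P k then g k * a k * x k else g k * (x (k + 7))⁻¹ * (a (k + 7))⁻¹)
      (fun k => if P k then x (k + 7) * a k * h k else (a (k + 1))⁻¹ * (x k)⁻¹ * h k) := by
  have h2 : ∀ k, P (k + 2) ↔ P k := fun k => by
    have := hP (k + 1); rw [add_assoc, hP k, not_not] at this; exact this
  have h3 : ∀ k, P (k + 3) ↔ ¬ P k := fun k => by
    have := hP (k + 2); rw [add_assoc, h2 k] at this; exact this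
  have h4 : ∀ k, P (k + 4) ↔ P k := fun k => by
    have := h2 (k + 2); rw [add_assoc, h2 k] at this; exact this
  have x7 : ∀ k, x (k + 7) = (x (k + 3))⁻¹ := fun k => by
    rw [← H.antipode₂, add_assoc]; rfl
  refine ⟨H.antipode₁, fun k => ?_, fun k => ?_, fun k => ?_, fun k => ?_⟩
  · by_cases hk : P k
    · have := H.antipode₂ (k + 7)
      simp only [add_assoc, Fin.reduceAdd] at this
      simp [hk, h4, add_assoc, this]
    · have := H.antipode₂ (k + 1)
      simp only [add_assoc, Fin.reduceAdd] at this
      simp [hk, h4, add_assoc, this]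
  · by_cases hk : P k
    · have e1 := H.inv_h (k + 5)
      have e2 := H.inv_g k
      have e3 := H.antipode₂ k
      have e4 := x7 k
      simp only [add_assoc, Fin.reduceAdd, add_zero] at e1
      simp only [hk, if_true, H.block, H.junction, mul_inv_rev, add_assoc, Fin.reduceAdd, inv_inv,
        e1, e2, e3, e4]
      group
    · simp only [hk, if_false, H.block]
      group
  · by_cases hk : P k
    · simp only [hk, hP, if_true, if_false, not_true, H.junction k, add_assoc, Fin.reduceAdd,
        add_zero]
      group
    · simp only [hk, hP, if_true, if_false, not_false_iff, H.junction k, add_assoc, Fin.reduceAdd]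
      group
  · have e := H.cross k
    have e4 := x7 k
    by_cases hk : P k
    · simp only [hk, h3, if_true, if_false, not_true, add_assoc, Fin.reduceAdd]
      have : x (k + 7) * a k * h k * (g (k + 3) * (x (k + 2))⁻¹ * (a (k + 2))⁻¹) =
        x (k + 7) * a k * (h k * g (k + 3)) * (x (k + 2))⁻¹ * (a (k + 2))⁻¹ := by group
      rw [this, e, e4]
      group
    · simp only [hk, h3, if_true, if_false, not_false_iff, add_assoc, Fin.reduceAdd]
      have : (a (k + 1))⁻¹ * (x k)⁻¹ * h k * (g (k + 3) * a (k + 3) * x (k + 3)) =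
        (a (k + 1))⁻¹ * (x k)⁻¹ * (h k * g (k + 3)) * a (k + 3) * x (k + 3) := by group
      rw [this, e, e4]
      group

/-- The step for the letter `h`. -/
theorem step_h (H : Gauge A X a x g h) (P : Fin 8 → Prop) [DecidablePred P]
    (hP : ∀ k, P (k + 1) ↔ ¬ P k) :
    Gauge
      (fun k => if P k then (A (k + 2) * X (k + 2) * A (k + 3) * X (k + 3) * A (k + 4) *
          X (k + 4) * A (k + 5) * X (k + 5) * A (k + 6))⁻¹
        else A (k + 7) * X (k + 7) * A k * X k * A (k + 1))
      (fun k => if P k then X (k + 7) else X (k + 1))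
      (fun k => if P k then (a (k + 3) * x (k + 3) * a (k + 4) * x (k + 4) * a (k + 5))⁻¹
        else a (k + 6) * x (k + 6) * a (k + 7) * x (k + 7) * a k * x k * a (k + 1) * x (k + 1) *
          a (k + 2))
      (fun k => if P k then x (k + 6) else x (k + 2))
      (fun k => if P k then g (k + 1) * a (k + 1) * x (k + 1)
        else g (k + 7) * (x (k + 6))⁻¹ * (a (k + 6))⁻¹)
      (fun k => if P k then x (k + 6) * a (k + 7) * h (k + 7)
        else (a (k + 2))⁻¹ * (x (k + 1))⁻¹ * h (k + 1)) := by
  have h2 : ∀ k, P (k + 2) ↔ P k := fun k => by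
    have := hP (k + 1); rw [add_assoc, hP k, not_not] at this; exact this
  have h3 : ∀ k, P (k + 3) ↔ ¬ P k := fun k => by
    have := hP (k + 2); rw [add_assoc, h2 k] at this; exact this
  have h4 : ∀ k, P (k + 4) ↔ P k := fun k => by
    have := h2 (k + 2); rw [add_assoc, h2 k] at this; exact this
  have x5 : ∀ k, x (k + 5) = (x (k + 1))⁻¹ := fun k => by
    rw [← H.antipode₂, add_assoc]; rfl
  have x6 : ∀ k, x (k + 6) = (x (k + 2))⁻¹ := fun k => by
    rw [← H.antipode₂, add_assoc]; rfl
  have x7 : ∀ k, x (k + 7) = (x (k + 3))⁻¹ := fun k => by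
    rw [← H.antipode₂, add_assoc]; rfl
  refine ⟨fun k => ?_, fun k => ?_, fun k => ?_, fun k => ?_, fun k => ?_⟩
  · by_cases hk : P k
    · have := H.antipode₁ (k + 7)
      simp only [add_assoc, Fin.reduceAdd] at this
      simp [hk, h4, add_assoc, this]
    · have := H.antipode₁ (k + 1)
      simp only [add_assoc, Fin.reduceAdd] at this
      simp [hk, h4, add_assoc, this]
  · by_cases hk : P k
    · have := H.antipode₂ (k + 6)
      simp only [add_assoc, Fin.reduceAdd] at this
      simp [hk, h4, add_assoc, this]
    · have := H.antipode₂ (k + 2)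
      simp only [add_assoc, Fin.reduceAdd] at this
      simp [hk, h4, add_assoc, this]
  · by_cases hk : P k
    · have e1 := H.inv_h (k + 6)
      have e2 := H.inv_g (k + 7)
      have e3 := x5 k
      have e4 := x6 k
      simp only [add_assoc, Fin.reduceAdd] at e1 e2
      simp only [hk, if_true, H.block, H.junction, mul_inv_rev, add_assoc, Fin.reduceAdd, inv_inv,
        e1, e2, e3, e4]
      group
    · simp only [hk, if_false, H.block, H.junction, add_assoc, Fin.reduceAdd, add_zero]
      group
  · by_cases hk : P k
    · have e := H.junction (k + 7)
      simp only [add_assoc, Fin.reduceAdd, add_zero] at e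
      simp only [hk, hP, if_true, if_false, not_true, e, add_assoc, Fin.reduceAdd, add_zero]
      group
    · have e := H.junction (k + 1)
      simp only [add_assoc, Fin.reduceAdd] at e
      simp only [hk, hP, if_true, if_false, not_false_iff, e, add_assoc, Fin.reduceAdd]
      group
  · by_cases hk : P k
    · have e := H.cross (k + 7)
      simp only [add_assoc, Fin.reduceAdd] at e
      simp only [hk, h3, if_true, if_false, not_true, add_assoc, Fin.reduceAdd, add_zero]
      have : x (k + 6) * a (k + 7) * h (k + 7) * (g (k + 2) * (x (k + 1))⁻¹ * (a (k + 1))⁻¹) =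
        x (k + 6) * a (k + 7) * (h (k + 7) * g (k + 2)) * (x (k + 1))⁻¹ * (a (k + 1))⁻¹ := by group
      rw [this, e, x6]
      group
    · have e := H.cross (k + 1)
      simp only [add_assoc, Fin.reduceAdd] at e
      simp only [hk, h3, if_true, if_false, not_false_iff, add_assoc, Fin.reduceAdd, add_zero]
      have : (a (k + 2))⁻¹ * (x (k + 1))⁻¹ * h (k + 1) * (g (k + 4) * a (k + 4) * x (k + 4)) =
        (a (k + 2))⁻¹ * (x (k + 1))⁻¹ * (h (k + 1) * g (k + 4)) * a (k + 4) * x (k + 4) := by group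
      rw [this, e, H.antipode₂, x6, x7]
      group

/-- Gauge-equivalent closed words are conjugate. -/
theorem isConj (H : Gauge A X a x g h) :
    IsConj
      (a 0 * x 0 * (a 1 * x 1) * (a 2 * x 2) * (a 3 * x 3) * (a 4 * x 4) * (a 5 * x 5) *
        (a 6 * x 6) * (a 7 * x 7))
      (A 0 * X 0 * (A 1 * X 1) * (A 2 * X 2) * (A 3 * X 3) * (A 4 * X 4) * (A 5 * X 5) *
        (A 6 * X 6) * (A 7 * X 7)) := by
  rw [isConj_iff]
  refine ⟨g 0, ?_⟩
  -- The factors `h` cancel within each pair and the factors `g` between consecutive pairs, so only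
  -- `g 0` survives, at both ends.
  have e : ∀ k, A k * X k = g k * (a k * x k) * (g (k + 1))⁻¹ := fun k => by
    rw [H.block, H.junction]; group
  simp only [e, Fin.reduceAdd]
  group

end Gauge

/-! ## The words of the second leaper cycle -/

/-- The direction labels along a reversed path. -/
def reverseWord (w : List (Fin 8)) : List (Fin 8) := (w.map (· + 4)).reverse

/-- The effect of lifting on the eight words that describe the paths of a proper cycle, when `U`
lists the words and `X` the labels of the moves between consecutive paths. -/
def nextWord (t : Letter) (U : Fin 8 → List (Fin 8)) (X : Fin 8 → Fin 8) (i : Fin 8) :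
    List (Fin 8) :=
  match t with
  | .f => if i.val % 2 = 0 then
      reverseWord (U (i + 3) ++ X (i + 3) :: (U (i + 4) ++ X (i + 4) :: U (i + 5))) else U i
  | .g => if i.val % 2 = 0 then U i else
      reverseWord (U (i + 3) ++ X (i + 3) :: (U (i + 4) ++ X (i + 4) :: U (i + 5)))
  | .h => if i.val % 2 = 0 then
      reverseWord (U (i + 2) ++ X (i + 2) :: (U (i + 3) ++ X (i + 3) :: (U (i + 4) ++
        X (i + 4) :: (U (i + 5) ++ X (i + 5) :: U (i + 6)))))
    else U (i + 7) ++ X (i + 7) :: (U i ++ X i :: U (i + 1))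

/-- The effect of lifting on the labels of the moves between consecutive paths. -/
def nextJunction (t : Letter) (X : Fin 8 → Fin 8) (i : Fin 8) : Fin 8 :=
  match t with
  | .f => X i
  | .g => X i
  | .h => if i.val % 2 = 0 then X (i + 7) else X (i + 1)

/-- The labels of the moves between consecutive paths of the lift by `e`. -/
def junctionLabel : List Letter → Fin 8 → Fin 8
  | [] => id
  | t :: e => nextJunction t (junctionLabel e)

/-- The words of the paths of the lift by `e` of a proper cycle of length eight. -/
def pathWord : List Letter → Fin 8 → List (Fin 8)
  | [] => fun _ => []
  | t :: e => nextWord t (pathWord e) (junctionLabel e)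

/-- The cyclic word of the lift by `e` of a proper cycle of length eight. -/
def secondWord (e : List Letter) : List (Fin 8) :=
  (List.ofFn fun i => pathWord e i ++ [junctionLabel e i]).flatten

/-! ## The words of the first leaper cycle -/

/-- A square of an oriented cycle of the leaper of a frame has a type `(i, b)`: it belongs to
section `i`, and the boolean `b` tells which of the two moves out of it comes next. -/
abbrev VertexType := Fin 8 × Bool

/-- The direction of the next move. -/
def outDir (τ : VertexType) : Fin 8 := if τ.2 then τ.1 + 3 else τ.1 + 4

/-- The direction of the previous move. -/
def inDir (τ : VertexType) : Fin 8 := if τ.2 then τ.1 else τ.1 + 7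

/-- The types of the lifts, in cyclic order, of a square of type `(i, true)`. -/
def liftTypePos (t : Letter) (i : Fin 8) : List VertexType :=
  match t with
  | .f => if i.val % 2 = 0 then [(i + 4, false)] else [(i + 5, true), (i, true), (i + 3, true)]
  | .g => if i.val % 2 = 0 then [(i + 5, true), (i, true), (i + 3, true)] else [(i + 4, false)]
  | .h => if i.val % 2 = 0 then
      [(i + 6, true), (i + 1, true), (i + 4, true), (i + 7, true), (i + 2, true)]
    else [(i + 3, false), (i, false), (i + 5, false)]

/-- The types of the lifts, in cyclic order, of a square of type `τ`. -/
def liftType (t : Letter) (τ : VertexType) : List VertexType :=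
  if τ.2 then liftTypePos t τ.1
  else ((liftTypePos t τ.1).map fun σ => (σ.1, !σ.2)).reverse

/-- The types of the lifts by `e`, in cyclic order, of a square of type `τ`. -/
def liftTypeSeq : List Letter → VertexType → List VertexType
  | [], τ => [τ]
  | t :: e, τ => (liftTypeSeq e τ).flatMap (liftType t)

/-- The types, in cyclic order, of the squares of a shell cycle. -/
def shellTypes : List VertexType :=
  [(0, true), (3, true), (6, true), (1, true), (4, true), (7, true), (2, true), (5, true)]

/-- The cyclic word of the lift by `e` of a shell cycle. -/
def firstWord (e : List Letter) : List (Fin 8) :=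
  (shellTypes.flatMap (liftTypeSeq e)).map outDir

/-- Substitutions compose associatively, so the letter applied first can be peeled off instead of
the one applied last. The induction over flips needs this side. -/
theorem liftTypeSeq_append (e : List Letter) (t : Letter) (τ : VertexType) :
    liftTypeSeq (e ++ [t]) τ = (liftType t τ).flatMap (liftTypeSeq e) := by
  induction e with
  | nil => simp [liftTypeSeq]
  | cons s e ih => simp only [List.cons_append, liftTypeSeq, ih, List.flatMap_assoc]

theorem flip_cons (t : Letter) (e : List Letter) : flip (t :: e) = flip e ++ [t.bar] := by
  simp [flip]

/-! ### Values of words in a group -/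

section Words

variable {G : Type*} [Group G] (L : Fin 8 → G)

/-- The product of the labels of a word. -/
def wordProd (w : List (Fin 8)) : G := (w.map L).prod

theorem wordProd_nil : wordProd L [] = 1 := by simp [wordProd]

theorem wordProd_cons (k : Fin 8) (w : List (Fin 8)) :
    wordProd L (k :: w) = L k * wordProd L w := by simp [wordProd]

theorem wordProd_append (v w : List (Fin 8)) :
    wordProd L (v ++ w) = wordProd L v * wordProd L w := by simp [wordProd]

theorem wordProd_reverseWord (hL : ∀ k, L (k + 4) = (L k)⁻¹) (w : List (Fin 8)) :
    wordProd L (reverseWord w) = (wordProd L w)⁻¹ := by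
  induction w with
  | nil => simp [wordProd, reverseWord]
  | cons k w ih =>
    have : reverseWord (k :: w) = reverseWord w ++ [k + 4] := by simp [reverseWord]
    rw [this, wordProd_append, ih, wordProd_cons, wordProd_cons, hL, wordProd_nil]
    group

/-- The product of the labels of the moves out of the lifts by `e` of a square of type `τ`. -/
def typeProd (e : List Letter) (τ : VertexType) : G :=
  wordProd L ((liftTypeSeq e τ).map fun σ => 3 * outDir σ + 6)

theorem typeProd_append (e : List Letter) (t : Letter) (τ : VertexType) :
    typeProd L (e ++ [t]) τ = ((liftType t τ).map (typeProd L e)).prod := by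
  rw [typeProd, liftTypeSeq_append]
  generalize liftType t τ = l
  induction l with
  | nil => simp [wordProd]
  | cons σ l ih =>
    rw [List.flatMap_cons, List.map_append, wordProd_append, ih, List.map_cons, List.prod_cons]
    rfl

/-- The type of index `k` along a shell cycle. -/
def typeA (k : Fin 8) : VertexType := (3 * k + 3, true)

/-- The type of index `k` along a reversed shell cycle. -/
def typeB (k : Fin 8) : VertexType := (3 * k + 7, false)

/-- The indexing puts index `k` in section `3k + 3` or `3k + 7`, of parity opposite to `k`. So `g`
keeps single squares at the even indices, which are the sections where `f` reverses blocks of the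
second cycle; this is the source of the bar in the flip. -/
theorem liftType_g_typeA (k : Fin 8) : liftType .g (typeA k) =
    if k.val % 2 = 0 then [typeB k] else [typeA (k + 7), typeA k, typeA (k + 1)] := by
  revert k; decide

theorem liftType_g_typeB (k : Fin 8) : liftType .g (typeB k) =
    if k.val % 2 = 0 then [typeA k] else [typeB (k + 1), typeB k, typeB (k + 7)] := by
  revert k; decide

theorem liftType_f_typeA (k : Fin 8) : liftType .f (typeA k) =
    if k.val % 2 = 0 then [typeA (k + 7), typeA k, typeA (k + 1)] else [typeB k] := by
  revert k; decide

theorem liftType_f_typeB (k : Fin 8) : liftType .f (typeB k) =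
    if k.val % 2 = 0 then [typeB (k + 1), typeB k, typeB (k + 7)] else [typeA k] := by
  revert k; decide

/-- For `h` the indices come out centred at the opposite index, hence the shift by four. -/
theorem liftType_h_typeA (k : Fin 8) : liftType .h (typeA (k + 4)) =
    if k.val % 2 = 0 then [typeB (k + 1), typeB k, typeB (k + 7)]
    else [typeA (k + 6), typeA (k + 7), typeA k, typeA (k + 1), typeA (k + 2)] := by
  revert k; decide

theorem liftType_h_typeB (k : Fin 8) : liftType .h (typeB (k + 4)) =
    if k.val % 2 = 0 then [typeA (k + 7), typeA k, typeA (k + 1)]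
    else [typeB (k + 2), typeB (k + 1), typeB k, typeB (k + 7), typeB (k + 6)] := by
  revert k; decide

end Words

/-! ### The gauge between the two recursions -/

section Words

variable {G : Type*} [Group G] (L : Fin 8 → G)

set_option linter.unusedSimpArgs false in
/-- The words of the first leaper cycle of descent `flip e` and of the second leaper cycle of
descent `e` are gauge-equivalent. -/
theorem exists_gauge (hL : ∀ k, L (k + 4) = (L k)⁻¹) (e : List Letter) :
    ∃ c : Fin 8, (c = 0 ∨ c = 4) ∧ ∃ a x g h : Fin 8 → G,
      Gauge (fun k => wordProd L (pathWord e k)) (fun k => L (junctionLabel e k)) a x g h ∧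
      (∀ k, typeProd L (flip e) (typeA (k + c)) = a k * x k) ∧
      ∀ k, typeProd L (flip e) (typeB (k + c)) = (a (k + 4))⁻¹ * x (k + 7) := by
  induction e with
  | nil =>
    -- For the empty string every path is a single square with empty word, so the gauge is trivial
    -- and only the junctions remain.
    refine ⟨0, Or.inl rfl, fun _ => 1, L, fun _ => 1, fun _ => 1, ⟨hL, hL, ?_, ?_, ?_⟩, ?_, ?_⟩
    · simp [pathWord, wordProd]
    · simp [junctionLabel]
    · simp
    · intro k
      have : 3 * outDir (typeA k) + 6 = k := by revert k; decide
      simp [typeProd, flip, liftTypeSeq, wordProd, this]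
    · intro k
      have : 3 * outDir (typeB k) + 6 = k + 7 := by revert k; decide
      simp [typeProd, flip, liftTypeSeq, wordProd, this]
  | cons t e ih =>
    obtain ⟨c, hc, a, x, g, h, H, hA, hB⟩ := ih
    have hc2 : ∀ k : Fin 8, (k + c).val % 2 = k.val % 2 := by
      rcases hc with rfl | rfl <;> decide
    have hac1 : ∀ k : Fin 8, k + c + 1 = k + 1 + c := fun k => by abel
    have hac2 : ∀ k : Fin 8, k + c + 2 = k + 2 + c := fun k => by abel
    have hac6 : ∀ k : Fin 8, k + c + 6 = k + 6 + c := fun k => by abel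
    have hac7 : ∀ k : Fin 8, k + c + 7 = k + 7 + c := fun k => by abel
    have x4 := H.antipode₂
    have x5 : ∀ k, x (k + 5) = (x (k + 1))⁻¹ := fun k => by
      rw [← H.antipode₂, add_assoc]; rfl
    have x6 : ∀ k, x (k + 6) = (x (k + 2))⁻¹ := fun k => by
      rw [← H.antipode₂, add_assoc]; rfl
    have x7 : ∀ k, x (k + 7) = (x (k + 3))⁻¹ := fun k => by
      rw [← H.antipode₂, add_assoc]; rfl
    have par0 : ∀ k : Fin 8, (k + 1).val % 2 = 0 ↔ ¬ k.val % 2 = 0 := by decide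
    have par1 : ∀ k : Fin 8, (k + 1).val % 2 = 1 ↔ ¬ k.val % 2 = 1 := by decide
    have neg1 : ∀ k : Fin 8, k.val % 2 = 1 ↔ ¬ k.val % 2 = 0 := by decide
    have par7 : ∀ k : Fin 8, (k + 7).val % 2 = 0 ↔ ¬ k.val % 2 = 0 := by decide
    have par4 : ∀ k : Fin 8, (k + 4).val % 2 = k.val % 2 := by decide
    have hc4 : c + 4 = 0 ∨ c + 4 = 4 := by
      rcases hc with rfl | rfl <;> decide
    -- The new letter is outermost for `pathWord`, but its bar is innermost for `typeProd`. The
    -- hypotheses on `typeA` and `typeB` for `e` thus evaluate each substituted list directly.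
    rw [flip_cons]
    simp only [typeProd_append]
    cases t with
    | f =>
      have S := H.step_fg (fun k => k.val % 2 = 0) par0
      have eA : (fun k => wordProd L (pathWord (.f :: e) k)) =
          fun k => if k.val % 2 = 0 then (wordProd L (pathWord e (k + 3)) * L (junctionLabel e (k + 3)) *
            wordProd L (pathWord e (k + 4)) * L (junctionLabel e (k + 4)) *
            wordProd L (pathWord e (k + 5)))⁻¹
          else wordProd L (pathWord e k) := by
        funext k
        simp only [pathWord, nextWord, neg1]
        split_ifs <;>
          simp_all only [wordProd_reverseWord L hL, wordProd_append, wordProd_cons, mul_assoc,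
            not_true_eq_false, not_false_eq_true]
      beta_reduce at S
      rw [← eA] at S
      refine ⟨c, hc, _, _, _, _, S, fun k => ?_, fun k => ?_⟩
      · simp only [Letter.bar, liftType_g_typeA, hc2, neg1]
        by_cases hk : k.val % 2 = 0 <;>
          simp only [hk, not_true_eq_false, not_false_eq_true, if_true, if_false,
            List.map_cons, List.map_nil, List.prod_cons, List.prod_nil, mul_one, hac6, hac7,
            hac1, hac2, hA, hB] <;>
          simp only [add_assoc, Fin.reduceAdd, add_zero, par4, par7, hk, not_true_eq_false,
            not_false_eq_true, if_true, if_false, mul_assoc, mul_inv_rev, inv_inv, x4, x5, x6, x7]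
      · simp only [Letter.bar, liftType_g_typeB, hc2, neg1]
        by_cases hk : k.val % 2 = 0 <;>
          simp only [hk, not_true_eq_false, not_false_eq_true, if_true, if_false,
            List.map_cons, List.map_nil, List.prod_cons, List.prod_nil, mul_one, hac6, hac7,
            hac1, hac2, hA, hB] <;>
          simp only [add_assoc, Fin.reduceAdd, add_zero, par4, par7, hk, not_true_eq_false,
            not_false_eq_true, if_true, if_false, mul_assoc, mul_inv_rev, inv_inv, x4, x5, x6, x7]
    | g =>
      have S := H.step_fg (fun k => k.val % 2 = 1) par1
      have eA : (fun k => wordProd L (pathWord (.g :: e) k)) =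
          fun k => if k.val % 2 = 1 then (wordProd L (pathWord e (k + 3)) * L (junctionLabel e (k + 3)) *
            wordProd L (pathWord e (k + 4)) * L (junctionLabel e (k + 4)) *
            wordProd L (pathWord e (k + 5)))⁻¹
          else wordProd L (pathWord e k) := by
        funext k
        simp only [pathWord, nextWord, neg1]
        split_ifs <;>
          simp_all only [wordProd_reverseWord L hL, wordProd_append, wordProd_cons, mul_assoc,
            not_true_eq_false, not_false_eq_true]
      beta_reduce at S
      rw [← eA] at S
      refine ⟨c, hc, _, _, _, _, S, fun k => ?_, fun k => ?_⟩
      · simp only [Letter.bar, liftType_f_typeA, hc2, neg1]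
        by_cases hk : k.val % 2 = 0 <;>
          simp only [hk, not_true_eq_false, not_false_eq_true, if_true, if_false,
            List.map_cons, List.map_nil, List.prod_cons, List.prod_nil, mul_one, hac6, hac7,
            hac1, hac2, hA, hB] <;>
          simp only [add_assoc, Fin.reduceAdd, add_zero, par4, par7, hk, not_true_eq_false,
            not_false_eq_true, if_true, if_false, mul_assoc, mul_inv_rev, inv_inv, x4, x5, x6, x7]
      · simp only [Letter.bar, liftType_f_typeB, hc2, neg1]
        by_cases hk : k.val % 2 = 0 <;>
          simp only [hk, not_true_eq_false, not_false_eq_true, if_true, if_false,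
            List.map_cons, List.map_nil, List.prod_cons, List.prod_nil, mul_one, hac6, hac7,
            hac1, hac2, hA, hB] <;>
          simp only [add_assoc, Fin.reduceAdd, add_zero, par4, par7, hk, not_true_eq_false,
            not_false_eq_true, if_true, if_false, mul_assoc, mul_inv_rev, inv_inv, x4, x5, x6, x7]
    | h =>
      have S := H.step_h (fun k => k.val % 2 = 0) par0
      have eA : (fun k => wordProd L (pathWord (.h :: e) k)) =
          fun k => if k.val % 2 = 0 then (wordProd L (pathWord e (k + 2)) *
            L (junctionLabel e (k + 2)) * wordProd L (pathWord e (k + 3)) *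
            L (junctionLabel e (k + 3)) * wordProd L (pathWord e (k + 4)) *
            L (junctionLabel e (k + 4)) * wordProd L (pathWord e (k + 5)) *
            L (junctionLabel e (k + 5)) * wordProd L (pathWord e (k + 6)))⁻¹
          else wordProd L (pathWord e (k + 7)) * L (junctionLabel e (k + 7)) *
            wordProd L (pathWord e k) * L (junctionLabel e k) * wordProd L (pathWord e (k + 1)) := by
        funext k
        simp only [pathWord, nextWord, neg1]
        split_ifs <;>
          simp_all only [wordProd_reverseWord L hL, wordProd_append, wordProd_cons, mul_assoc,
            not_true_eq_false, not_false_eq_true]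
      beta_reduce at S
      have eX : (fun k => L (junctionLabel (.h :: e) k)) = fun k => if k.val % 2 = 0 then
          L (junctionLabel e (k + 7)) else L (junctionLabel e (k + 1)) := by
        funext k
        simp only [junctionLabel, nextJunction]
        split_ifs <;> rfl
      rw [← eA, ← eX] at S
      -- Each `h` toggles the offset between the two indexings, by the shift by four in
      -- `liftType_h_typeA`.
      refine ⟨c + 4, hc4, _, _, _, _, S, fun k => ?_, fun k => ?_⟩
      · simp only [Letter.bar, ← add_assoc, liftType_h_typeA, hc2, neg1]
        by_cases hk : k.val % 2 = 0 <;>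
          simp only [hk, not_true_eq_false, not_false_eq_true, if_true, if_false,
            List.map_cons, List.map_nil, List.prod_cons, List.prod_nil, mul_one, hac6, hac7,
            hac1, hac2, hA, hB] <;>
          simp only [add_assoc, Fin.reduceAdd, add_zero, par4, par7, hk, not_true_eq_false,
            not_false_eq_true, if_true, if_false, mul_assoc, mul_inv_rev, inv_inv, x4, x5, x6, x7]
      · simp only [Letter.bar, ← add_assoc, liftType_h_typeB, hc2, neg1]
        by_cases hk : k.val % 2 = 0 <;>
          simp only [hk, not_true_eq_false, not_false_eq_true, if_true, if_false,
            List.map_cons, List.map_nil, List.prod_cons, List.prod_nil, mul_one, hac6, hac7,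
            hac1, hac2, hA, hB] <;>
          simp only [add_assoc, Fin.reduceAdd, add_zero, par4, par7, hk, not_true_eq_false,
            not_false_eq_true, if_true, if_false, mul_assoc, mul_inv_rev, inv_inv, x4, x5, x6, x7]

end Words

/-! ### From conjugacy to rotation -/

theorem isConj_words {G : Type*} [Group G] (L : Fin 8 → G) (hL : ∀ k, L (k + 4) = (L k)⁻¹)
    (e : List Letter) :
    IsConj (wordProd L ((firstWord (flip e)).map fun d => 3 * d + 6))
      (wordProd L (secondWord e)) := by
  obtain ⟨c, hc, a, x, g, h, H, hA, -⟩ := exists_gauge L hL e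
  have h2 : wordProd L (secondWord e) = (wordProd L (pathWord e 0) * L (junctionLabel e 0) *
      (wordProd L (pathWord e 1) * L (junctionLabel e 1)) *
      (wordProd L (pathWord e 2) * L (junctionLabel e 2)) *
      (wordProd L (pathWord e 3) * L (junctionLabel e 3)) *
      (wordProd L (pathWord e 4) * L (junctionLabel e 4)) *
      (wordProd L (pathWord e 5) * L (junctionLabel e 5)) *
      (wordProd L (pathWord e 6) * L (junctionLabel e 6)) *
      (wordProd L (pathWord e 7) * L (junctionLabel e 7))) := by
    simp [secondWord, List.ofFn_succ, wordProd, mul_assoc]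
  have h1 : wordProd L ((firstWord (flip e)).map fun d => 3 * d + 6) =
      typeProd L (flip e) (typeA 7) * typeProd L (flip e) (typeA 0) *
      typeProd L (flip e) (typeA 1) * typeProd L (flip e) (typeA 2) *
      typeProd L (flip e) (typeA 3) * typeProd L (flip e) (typeA 4) *
      typeProd L (flip e) (typeA 5) * typeProd L (flip e) (typeA 6) := by
    have : shellTypes = [typeA 7, typeA 0, typeA 1, typeA 2, typeA 3, typeA 4, typeA 5, typeA 6] := by
      decide
    simp only [firstWord, this, List.map_map, List.flatMap_cons, List.flatMap_nil, List.map_append,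
      wordProd_append, mul_assoc, List.map_nil, wordProd_nil, mul_one, typeProd]
    rfl
  rw [h2]
  refine IsConj.trans ?_ H.isConj
  rw [h1, isConj_iff]
  -- The shell types start at index 7 and the offset is 0 or 4; the conjugating element moves the
  -- product round until it starts at `a 0`.
  rcases hc with rfl | rfl
  · simp only [add_zero] at hA
    simp only [hA]
    refine ⟨(a 7 * x 7)⁻¹, ?_⟩
    group
  · have e7 := hA 3
    have e6 := hA 2
    have e5 := hA 1
    have e4 := hA 0
    have e3 := hA 7
    have e2 := hA 6
    have e1 := hA 5
    have e0 := hA 4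
    simp only [Fin.reduceAdd, zero_add] at e0 e1 e2 e3 e4 e5 e6 e7
    rw [e0, e1, e2, e3, e4, e5, e6, e7]
    refine ⟨(a 3 * x 3 * a 4 * x 4 * a 5 * x 5 * a 6 * x 6 * a 7 * x 7)⁻¹, ?_⟩
    group

/-- The letter of the free group on four generators that stands for a skew direction. -/
def dirLetter (k : Fin 8) : Fin 4 × Bool := (⟨k.val % 4, by omega⟩, decide (k.val < 4))

theorem dirLetter_injective : Function.Injective dirLetter := by decide

/-- No move of the closed word `w` is undone by the next one. -/
def NoBacktrack (w : List (Fin 8)) : Prop :=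
  w.IsChain (fun a b => b ≠ a + 4) ∧ ∀ a ∈ w.getLast?, ∀ b ∈ w.head?, b ≠ a + 4

theorem NoBacktrack.isCyclicallyReduced {w : List (Fin 8)} (h : NoBacktrack w) :
    IsCyclicallyReduced (w.map dirLetter) := by
  have key : ∀ a b : Fin 8, b ≠ a + 4 → (dirLetter a).1 = (dirLetter b).1 →
      (dirLetter a).2 = (dirLetter b).2 := by decide
  refine ⟨?_, ?_⟩
  · unfold FreeGroup.IsReduced
    rw [List.isChain_map]
    exact h.1.imp key
  · intro a ha b hb
    simp only [List.getLast?_map, List.head?_map, Option.mem_def, Option.map_eq_some_iff] at ha hb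
    obtain ⟨a', ha', rfl⟩ := ha
    obtain ⟨b', hb', rfl⟩ := hb
    exact key a' b' (h.2 a' ha' b' hb')

/-- The conjugacy is specialised to the free group on four generators, where opposite directions are
inverse and otherwise unrelated. Injectivity of `dirLetter` brings the rotation back from letters to
directions. -/
theorem isRotated_words (e : List Letter)
    (h₁ : NoBacktrack ((firstWord (flip e)).map fun d => 3 * d + 6))
    (h₂ : NoBacktrack (secondWord e)) :
    ((firstWord (flip e)).map fun d => 3 * d + 6) ~r secondWord e := by
  have hL : ∀ k, mk [dirLetter (k + 4)] = (mk [dirLetter k])⁻¹ := by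
    have : ∀ k, dirLetter (k + 4) = ((dirLetter k).1, !(dirLetter k).2) := by decide
    intro k
    simp [this, invRev]
  have hp : ∀ w, wordProd (fun k => mk [dirLetter k]) w = mk (w.map dirLetter) := by
    intro w
    induction w with
    | nil => rw [wordProd_nil, List.map_nil, one_eq_mk]
    | cons k w ih => rw [wordProd_cons, ih, mul_mk]; rfl
  have := isConj_words (fun k => mk [dirLetter k]) hL e
  rw [hp, hp] at this
  obtain ⟨n, hn⟩ := isRotated_of_isConj h₁.isCyclicallyReduced h₂.isCyclicallyReduced this
  refine ⟨n, ?_⟩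
  rw [← List.map_rotate] at hn
  exact dirLetter_injective.list_map hn

/-! ## Closedness of the words -/

theorem junctionLabel_antipode (e : List Letter) (k : Fin 8) :
    junctionLabel e (k + 4) = junctionLabel e k + 4 := by
  induction e generalizing k with
  | nil => rfl
  | cons t e ih =>
    have h4 : (k + 4).val % 2 = k.val % 2 := by revert k; decide
    have h7 := ih (k + 7)
    have h1 := ih (k + 1)
    simp only [add_assoc, Fin.reduceAdd] at h7 h1
    cases t <;> simp only [junctionLabel, nextJunction, ih, h4, add_assoc, Fin.reduceAdd]
    split_ifs <;> assumption

/-- The second cycle is traversed with central symmetry: opposite paths have opposite labels in the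
same order, and gluing and reversal preserve this. -/
theorem pathWord_antipode (e : List Letter) (k : Fin 8) :
    pathWord e (k + 4) = (pathWord e k).map (· + 4) := by
  induction e generalizing k with
  | nil => rfl
  | cons t e ih =>
    have h4 : (k + 4).val % 2 = k.val % 2 := by revert k; decide
    have hr : ∀ w, (reverseWord w).map (· + 4) = reverseWord (w.map (· + 4)) := fun w => by
      simp [reverseWord]
    have h : ∀ j, pathWord e (k + (j + 4)) = (pathWord e (k + j)).map (· + 4) := fun j => by
      rw [← add_assoc, ih]
    have h' : ∀ j, junctionLabel e (k + (j + 4)) = junctionLabel e (k + j) + 4 := fun j => by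
      rw [← add_assoc, junctionLabel_antipode]
    have a0 := h 0
    have a1 := h 1
    have a2 := h 2
    have a3 := h 3
    have b0 := h' 0
    have b1 := h' 1
    have b2 := h' 2
    have b3 := h' 3
    have hm : ∀ w : List (Fin 8), (w.map (· + 4)).map (· + 4) = w := fun w => by
      simp [Function.comp_def, add_assoc]
    have hj : ∀ i : Fin 8, i + 4 + 4 = i := by decide
    simp only [Fin.reduceAdd, add_zero] at a0 a1 a2 a3 b0 b1 b2 b3
    cases t <;> simp only [pathWord, nextWord, h4, add_assoc, Fin.reduceAdd] <;> split_ifs <;>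
      simp only [hr, a0, a1, a2, a3, b0, b1, b2, b3, List.map_append, List.map_cons, hm, hj,
        add_zero]

theorem liftTypeSeq_antipode (e : List Letter) (τ : VertexType) :
    liftTypeSeq e (τ.1 + 4, τ.2) = (liftTypeSeq e τ).map fun σ => (σ.1 + 4, σ.2) := by
  induction e with
  | nil => rfl
  | cons t e ih =>
    have : ∀ σ : VertexType, liftType t (σ.1 + 4, σ.2) =
      (liftType t σ).map fun σ => (σ.1 + 4, σ.2) := by
      cases t <;> decide
    simp only [liftTypeSeq, ih, List.flatMap_map, List.map_flatMap, this]

theorem dirMatrix_antipode (k : Fin 8) : dirMatrix (k + 4) = -dirMatrix k := by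
  revert k; decide

/-- The sum of the matrices of the labels of a word. -/
def matrixSum (w : List (Fin 8)) : Matrix (Fin 2) (Fin 2) ℤ := (w.map dirMatrix).sum

theorem matrixSum_append (v w : List (Fin 8)) :
    matrixSum (v ++ w) = matrixSum v + matrixSum w := by simp [matrixSum]

theorem matrixSum_antipode (w : List (Fin 8)) : matrixSum (w.map (· + 4)) = -matrixSum w := by
  induction w with
  | nil => simp [matrixSum]
  | cons k w ih =>
    simp only [matrixSum, List.map_cons, List.sum_cons, dirMatrix_antipode] at ih ⊢
    rw [ih, neg_add]

/-- A half-turn negates the contribution of every square, and the shell types fall into four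
opposite pairs. -/
theorem matrixSum_firstWord (e : List Letter) : matrixSum (firstWord e) = 0 := by
  have h : ∀ τ : VertexType, matrixSum ((liftTypeSeq e (τ.1 + 4, τ.2)).map outDir) =
      -matrixSum ((liftTypeSeq e τ).map outDir) := by
    intro τ
    rw [← matrixSum_antipode, liftTypeSeq_antipode, List.map_map, List.map_map]
    congr 2
    funext σ
    rcases σ with ⟨i, b⟩
    revert i b; decide
  have h0 := h (0, true)
  have h1 := h (1, true)
  have h2 := h (2, true)
  have h3 := h (3, true)
  simp only [Fin.reduceAdd, zero_add] at h0 h1 h2 h3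
  simp only [firstWord, shellTypes, List.flatMap_cons, List.flatMap_nil, List.map_append,
    matrixSum_append, h0, h1, h2, h3, List.append_nil]
  abel

/-- Opposite paths and junctions cancel. The relabelling `ρ` is left free because the actual moves
are obtained from the word through `originDirection`. -/
theorem matrixSum_secondWord (e : List Letter) (ρ : Fin 8 → Fin 8)
    (hρ : ∀ k, ρ (k + 4) = ρ k + 4) : matrixSum ((secondWord e).map ρ) = 0 := by
  have h : ∀ k, matrixSum ((pathWord e (k + 4) ++ [junctionLabel e (k + 4)]).map ρ) =
      -matrixSum ((pathWord e k ++ [junctionLabel e k]).map ρ) := by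
    intro k
    rw [pathWord_antipode, junctionLabel_antipode, ← matrixSum_antipode]
    congr 1
    simp [hρ]
  have h0 := h 0
  have h1 := h 1
  have h2 := h 2
  have h3 := h 3
  simp only [Fin.reduceAdd, zero_add] at h0 h1 h2 h3
  have : secondWord e = (pathWord e 0 ++ [junctionLabel e 0]) ++
      ((pathWord e 1 ++ [junctionLabel e 1]) ++ ((pathWord e 2 ++ [junctionLabel e 2]) ++
      ((pathWord e 3 ++ [junctionLabel e 3]) ++ ((pathWord e 4 ++ [junctionLabel e 4]) ++
      ((pathWord e 5 ++ [junctionLabel e 5]) ++ ((pathWord e 6 ++ [junctionLabel e 6]) ++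
      (pathWord e 7 ++ [junctionLabel e 7]))))))) := by
    simp [secondWord, List.ofFn_succ]
  rw [this]
  simp only [List.map_append, matrixSum_append] at h0 h1 h2 h3 ⊢
  calc _ = matrixSum ((pathWord e 0).map ρ) + matrixSum ([junctionLabel e 0].map ρ) +
        (matrixSum ((pathWord e 1).map ρ) + matrixSum ([junctionLabel e 1].map ρ)) +
        (matrixSum ((pathWord e 2).map ρ) + matrixSum ([junctionLabel e 2].map ρ)) +
        (matrixSum ((pathWord e 3).map ρ) + matrixSum ([junctionLabel e 3].map ρ)) +
        (matrixSum ((pathWord e 4).map ρ) + matrixSum ([junctionLabel e 4].map ρ)) +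
        (matrixSum ((pathWord e 5).map ρ) + matrixSum ([junctionLabel e 5].map ρ)) +
        (matrixSum ((pathWord e 6).map ρ) + matrixSum ([junctionLabel e 6].map ρ)) +
        (matrixSum ((pathWord e 7).map ρ) + matrixSum ([junctionLabel e 7].map ρ)) := by abel
    _ = 0 := by rw [h0, h1, h2, h3]; abel
end Leaper

namespace Leaper

/-! ## Cyclic lists -/

/-- The entries of the list `l`, read cyclically. -/
def cyc {α : Type*} [Inhabited α] (l : List α) (k : ℕ) : α := l.getD (k % l.length) default

section Cyc

variable {α : Type*} [Inhabited α] {l : List α}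

theorem cyc_of_lt {k : ℕ} (hk : k < l.length) : cyc l k = l[k] := by
  simp [cyc, Nat.mod_eq_of_lt hk, hk]

theorem cyc_congr {j k : ℕ} (h : j % l.length = k % l.length) : cyc l j = cyc l k := by
  rw [cyc, cyc, h]

theorem cyc_mod (k : ℕ) : cyc l (k % l.length) = cyc l k := cyc_congr (Nat.mod_mod _ _)

theorem cyc_mem (hl : l ≠ []) (k : ℕ) : cyc l k ∈ l := by
  rw [← cyc_mod, cyc_of_lt (Nat.mod_lt _ (List.length_pos_iff.2 hl))]
  exact List.getElem_mem _

theorem mem_iff_exists_cyc (hl : l ≠ []) {x : α} : x ∈ l ↔ ∃ k, cyc l k = x := by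
  refine ⟨fun h => ?_, ?_⟩
  · obtain ⟨k, hk, rfl⟩ := List.getElem_of_mem h
    exact ⟨k, cyc_of_lt hk⟩
  · rintro ⟨k, rfl⟩
    exact cyc_mem hl k

theorem cyc_inj (hl : l.Nodup) (h0 : l ≠ []) {j k : ℕ} :
    cyc l j = cyc l k ↔ j % l.length = k % l.length := by
  refine ⟨fun h => ?_, cyc_congr⟩
  have hp := List.length_pos_iff.2 h0
  rw [← cyc_mod j, ← cyc_mod k, cyc_of_lt (Nat.mod_lt _ hp), cyc_of_lt (Nat.mod_lt _ hp)] at h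
  exact (List.Nodup.getElem_inj_iff hl).1 h

theorem cyc_map {β : Type*} [Inhabited β] (f : α → β) (hl : l ≠ []) (k : ℕ) :
    cyc (l.map f) k = f (cyc l k) := by
  have hp := List.length_pos_iff.2 hl
  have hk := Nat.mod_lt k hp
  rw [← cyc_mod, ← cyc_mod (l := l), List.length_map, cyc_of_lt hk,
    cyc_of_lt (by simpa using hk), List.getElem_map]

theorem cyc_rotate (hl : l ≠ []) (n k : ℕ) : cyc (l.rotate n) k = cyc l (k + n) := by
  have hp := List.length_pos_iff.2 hl
  have hk := Nat.mod_lt k hp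
  rw [← cyc_mod, ← cyc_mod (l := l), List.length_rotate,
    cyc_of_lt (by simpa using hk), List.getElem_rotate, cyc_of_lt (Nat.mod_lt _ hp)]
  simp

end Cyc

/-! ## Cycles of leapers as lists of squares -/

/-- The closed list `l` of squares follows the cyclic word `w`, the label `i` standing for the
translation `v i`. -/
structure Follows (v : Fin 8 → Square) (l : List Square) (w : List (Fin 8)) : Prop where
  length_eq : w.length = l.length
  step : ∀ k, cyc l (k + 1) = cyc l k + v (cyc w k)

/-- Undoing a move would bring the cycle back to the same square after two steps, impossible for at
least three distinct squares. -/
theorem Follows.noBacktrack {v : Fin 8 → Square} {l : List Square} {w : List (Fin 8)}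
    (h : Follows v l w) (hv : ∀ i, v (i + 4) = -v i) (hl : l.Nodup) (h3 : 3 ≤ l.length) :
    NoBacktrack w := by
  have h0 : l ≠ [] := by rintro rfl; simp at h3
  have key : ∀ k, cyc w (k + 1) ≠ cyc w k + 4 := by
    intro k hk
    have e : cyc l (k + 1 + 1) = cyc l k := by
      rw [h.step, h.step, hk, hv]
      abel
    rw [cyc_inj hl h0] at e
    have : (k + 2) % l.length = (k + 0) % l.length := e
    have := Nat.ModEq.add_left_cancel' k this
    rw [Nat.ModEq, Nat.mod_eq_of_lt (by omega), Nat.zero_mod] at this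
    omega
  constructor
  · rw [List.isChain_iff_getElem]
    intro k hk
    have := key k
    rwa [cyc_of_lt (by omega), cyc_of_lt (by omega)] at this
  · have hw : w ≠ [] := by
      rintro rfl
      have := h.length_eq
      simp at this
      omega
    have hp := List.length_pos_iff.2 hw
    intro a ha b hb
    have := key (w.length - 1)
    have e : cyc w (w.length - 1 + 1) = w[0] := by
      rw [Nat.sub_add_cancel hp, cyc_congr (k := 0) (by simp), cyc_of_lt hp]
    rw [e, cyc_of_lt (Nat.sub_lt hp Nat.one_pos)] at this
    rw [List.getLast?_eq_getElem?, Option.mem_def, List.getElem?_eq_some_iff] at ha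
    rw [List.head?_eq_getElem?, Option.mem_def, List.getElem?_eq_some_iff] at hb
    obtain ⟨_, rfl⟩ := ha
    obtain ⟨_, rfl⟩ := hb
    exact this

section CycleThrough

variable {p q : ℤ} {l : List Square} {C : (leaperGraph p q).Subgraph}

theorem exists_walk_of_adj {V : Type*} {G : SimpleGraph V} (f : ℕ → V)
    (hf : ∀ k, G.Adj (f k) (f (k + 1))) (n : ℕ) :
    ∃ w : G.Walk (f 0) (f n), w.support = (List.range (n + 1)).map f := by
  induction n with
  | zero => exact ⟨.nil, by simp⟩
  | succ n ih =>
    obtain ⟨w, hw⟩ := ih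
    refine ⟨w.concat (hf n), ?_⟩
    rw [SimpleGraph.Walk.support_concat, hw, List.range_succ (n := n + 1)]
    simp

theorem exists_isCycleThrough (hl : l.Nodup) (h3 : 3 ≤ l.length)
    (hadj : ∀ k, (leaperGraph p q).Adj (cyc l k) (cyc l (k + 1))) :
    ∃ C : (leaperGraph p q).Subgraph, IsCycleThrough l C := by
  have h0 : l ≠ [] := by rintro rfl; simp at h3
  obtain ⟨w, hw⟩ := exists_walk_of_adj _ hadj l.length
  have hN : cyc l l.length = cyc l 0 := cyc_congr (by simp)
  have hlen : w.length = l.length := by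
    have := congrArg List.length hw
    simpa using this
  have hd : w.support.dropLast = l := by
    rw [hw, List.range_succ, List.map_append, List.map_singleton, List.dropLast_concat]
    apply List.ext_getElem
    · simp
    · intro k h1 h2
      simp [cyc_of_lt h2]
  refine ⟨_, cyc l 0, w.copy rfl hN, ?_, by simpa using hd, rfl⟩
  rw [SimpleGraph.Walk.isCycle_iff_isPath_tail_and_le_length]
  refine ⟨?_, by simpa [hlen] using h3⟩
  have hnil : ¬ (w.copy rfl hN).Nil := by
    rw [SimpleGraph.Walk.not_nil_iff_lt_length]
    simp only [SimpleGraph.Walk.length_copy, hlen]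
    omega
  rw [SimpleGraph.Walk.isPath_def, SimpleGraph.Walk.support_tail_of_not_nil _ hnil,
    (SimpleGraph.Walk.tail_support_perm_dropLast_support _).nodup_iff]
  simpa [hd] using hl

theorem IsCycleThrough.isCycle (h : IsCycleThrough l C) : IsCycle C := by
  obtain ⟨a, w, hw, -, hC⟩ := h
  exact ⟨a, w, hw, hC⟩

theorem IsCycleThrough.nodup (h : IsCycleThrough l C) : l.Nodup := by
  obtain ⟨a, w, hw, rfl, -⟩ := h
  exact hw.nodup_dropLast_support

theorem IsCycleThrough.three_le (h : IsCycleThrough l C) : 3 ≤ l.length := by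
  obtain ⟨a, w, hw, rfl, -⟩ := h
  simpa using hw.three_le_length

theorem IsCycleThrough.getVert {a : Square} {w : (leaperGraph p q).Walk a a} (hw : w.IsCycle)
    {k : ℕ} (hk : k ≤ w.length) : w.getVert k = cyc w.support.dropLast k := by
  have h3 := hw.three_le_length
  rcases hk.lt_or_eq with hk | rfl
  · rw [cyc_of_lt (by simpa using hk)]
    simp [SimpleGraph.Walk.getVert_eq_support_getElem _ hk.le]
  · rw [SimpleGraph.Walk.getVert_length, cyc_congr (k := 0) (by simp),
      cyc_of_lt (by simp; omega)]
    simp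

theorem IsCycleThrough.mem_verts (h : IsCycleThrough l C) {x : Square} : x ∈ C.verts ↔ x ∈ l := by
  have h3 := h.three_le
  obtain ⟨a, w, hw, rfl, rfl⟩ := h
  rw [SimpleGraph.Walk.mem_verts_toSubgraph]
  refine ⟨fun h => ?_, fun h => List.mem_of_mem_dropLast h⟩
  obtain ⟨k, rfl, hk⟩ := SimpleGraph.Walk.mem_support_iff_exists_getVert.1 h
  rw [IsCycleThrough.getVert hw hk]
  exact cyc_mem (by rintro h; simp [h] at h3) _

theorem IsCycleThrough.adj_iff (h : IsCycleThrough l C) {x y : Square} :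
    C.Adj x y ↔ ∃ k, x = cyc l k ∧ y = cyc l (k + 1) ∨ x = cyc l (k + 1) ∧ y = cyc l k := by
  obtain ⟨a, w, hw, rfl, rfl⟩ := h
  have h3 := hw.three_le_length
  rw [SimpleGraph.Walk.toSubgraph_adj_iff]
  constructor
  · rintro ⟨k, hk, hlt⟩
    rw [IsCycleThrough.getVert hw hlt.le, IsCycleThrough.getVert hw hlt, Sym2.eq_iff] at hk
    refine ⟨k, ?_⟩
    tauto
  · rintro ⟨k, hk⟩
    have hlt : k % w.length < w.length := Nat.mod_lt _ (by omega)
    refine ⟨k % w.length, ?_, hlt⟩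
    rw [IsCycleThrough.getVert hw hlt.le, IsCycleThrough.getVert hw hlt, Sym2.eq_iff]
    have e1 : cyc w.support.dropLast (k % w.length) = cyc w.support.dropLast k :=
      cyc_congr (by simp)
    have e2 : cyc w.support.dropLast (k % w.length + 1) = cyc w.support.dropLast (k + 1) :=
      cyc_congr (by simp)
    rw [e1, e2]
    tauto

end CycleThrough

/-! ## Direction graphs of closed words -/

/-- The move of direction `i` of the `(p, q)`-leaper. -/
def dirVec (p q : ℤ) : Fin 8 → Square :=
  ![(q, p), (p, q), (-p, q), (-q, p), (-q, -p), (-p, -q), (p, -q), (q, -p)]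

theorem isMoveOfDirection_iff {p q : ℤ} {i : Fin 8} {v : Square} :
    IsMoveOfDirection p q i v ↔ v = dirVec p q i := by
  rcases v with ⟨a, b⟩
  unfold IsMoveOfDirection
  rw [funext_iff, Fin.forall_fin_two, Prod.ext_iff]
  fin_cases i <;> simp [dirMatrix, dirVec, Matrix.mulVec, dotProduct, Fin.sum_univ_two]

theorem dirVec_antipode (p q : ℤ) (i : Fin 8) : dirVec p q (i + 4) = -dirVec p q i := by
  fin_cases i <;> simp [dirVec]

theorem dirVec_injective {p q : ℤ} (hp : 0 < p) (hq : p < q) :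
    Function.Injective (dirVec p q) := by
  intro i j h
  fin_cases i <;> fin_cases j <;> simp [dirVec] at h ⊢ <;> omega

theorem isMove_dirVec {p q : ℤ} (hp : 0 < p) (hq : p < q) (i : Fin 8) :
    IsMove p q (dirVec p q i) := by
  have h1 := abs_of_pos hp
  have h2 := abs_of_pos (hp.trans hq)
  fin_cases i <;> simp [dirVec, IsMove, h1, h2]

theorem exists_dirVec {p q : ℤ} (hp : 0 < p) (hq : p < q) {v : Square} (h : IsMove p q v) :
    ∃ i, v = dirVec p q i := by
  rcases v with ⟨a, b⟩
  simp only [IsMove, abs_eq hp.le, abs_eq (hp.trans hq).le] at h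
  rcases h with ⟨h1 | h1, h2 | h2⟩ | ⟨h1 | h1, h2 | h2⟩ <;> subst h1 h2
  exacts [⟨1, rfl⟩, ⟨6, rfl⟩, ⟨2, rfl⟩, ⟨5, rfl⟩, ⟨0, rfl⟩, ⟨7, rfl⟩, ⟨3, rfl⟩, ⟨4, rfl⟩]

theorem leaperGraph_adj_iff {p q : ℤ} (hp : 0 < p) (hq : p < q) {a b : Square} :
    (leaperGraph p q).Adj a b ↔ ∃ i, b = a + dirVec p q i := by
  constructor
  · rintro ⟨-, h⟩
    obtain ⟨i, hi⟩ := exists_dirVec hp hq h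
    exact ⟨i, by rw [← hi]; abel⟩
  · rintro ⟨i, rfl⟩
    refine ⟨?_, by simpa using isMove_dirVec hp hq i⟩
    intro h
    have : dirVec p q i = 0 := by simpa using h.symm
    rw [Prod.ext_iff] at this
    fin_cases i <;> simp [dirVec] at this <;> omega

/-- `Φ` is the direction graph of the closed word `w`. -/
def DirectionGraph.IsOfWord {V : Type*} (Φ : DirectionGraph V) (w : List (Fin 8)) : Prop :=
  w ≠ [] ∧ ∃ f : ℕ → V, Function.Surjective f ∧
    (∀ j k, f j = f k ↔ j % w.length = k % w.length) ∧
    ∀ x y i, Φ.Arc x y i ↔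
      ∃ k, x = f k ∧ y = f (k + 1) ∧ i = cyc w k ∨ x = f (k + 1) ∧ y = f k ∧ i = cyc w k + 4

theorem DirectionGraph.IsOfWord.rotate {V : Type*} {Φ : DirectionGraph V} {w : List (Fin 8)}
    (h : Φ.IsOfWord w) (n : ℕ) : Φ.IsOfWord (w.rotate n) := by
  obtain ⟨hw, f, hf, hinj, harc⟩ := h
  have hp := List.length_pos_iff.2 hw
  have back : ∀ k, ∃ j, (j + n) % w.length = k % w.length := by
    intro k
    -- This index plays the role of `k - n` modulo the length, without leaving the natural numbers.
    refine ⟨k + n * (w.length - 1), ?_⟩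
    have : k + n * (w.length - 1) + n = k + n * w.length := by
      obtain ⟨m, hm⟩ := Nat.exists_eq_add_of_lt hp
      rw [hm]
      simp
      ring
    rw [this]
    simp
  refine ⟨by simpa using hw, fun k => f (k + n), ?_, ?_, ?_⟩
  · intro x
    obtain ⟨k, rfl⟩ := hf x
    obtain ⟨j, hj⟩ := back k
    exact ⟨j, (hinj _ _).2 hj⟩
  · intro j k
    rw [hinj, List.length_rotate]
    constructor
    · exact fun h => Nat.ModEq.add_right_cancel' n h
    · exact fun h => Nat.ModEq.add_right n h
  · intro x y i
    rw [harc]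
    simp only [cyc_rotate hw]
    constructor
    · rintro ⟨k, hk⟩
      obtain ⟨j, hj⟩ := back k
      have h1 : f (j + n) = f k := (hinj _ _).2 hj
      have h2 : f (j + 1 + n) = f (k + 1) := (hinj _ _).2 (by
        rw [add_right_comm]; exact Nat.ModEq.add_right 1 hj)
      refine ⟨j, ?_⟩
      rw [h1, h2, cyc_congr hj]
      exact hk
    · rintro ⟨k, hk⟩
      exact ⟨k + n, by rwa [add_right_comm] at hk⟩

/-- The position along the word determines the vertex, so matching positions gives the renaming.
Compatibility of `π` with the antipode is needed because each step of the word also yields the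
opposite arc. -/
theorem DirectionGraph.IsOfWord.equivalent {V V' : Type*} {Φ : DirectionGraph V}
    {Φ' : DirectionGraph V'} {w w' : List (Fin 8)} (h : Φ.IsOfWord w) (h' : Φ'.IsOfWord w')
    (π : Equiv.Perm (Fin 8)) (hπ : IsEquivalencePerm π) (hπ4 : ∀ i, π (i + 4) = π i + 4)
    (hw : w.map π ~r w') : Φ.Equivalent Φ' := by
  obtain ⟨n, rfl⟩ := hw
  rw [← List.map_rotate] at h'
  obtain ⟨hw, f, hf, hinj, harc⟩ := h.rotate n
  obtain ⟨-, f', hf', hinj', harc'⟩ := h'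
  rw [List.length_map] at hinj'
  have hff : ∀ j k, f j = f k ↔ f' j = f' k := fun j k => by rw [hinj, hinj']
  choose r hr using hf
  have hτ : ∀ k, f' (r (f k)) = f' k := fun k => (hff _ _).1 (hr _)
  have hbij : Function.Bijective fun x => f' (r x) := by
    constructor
    · intro x y hxy
      rw [← hr x, ← hr y]
      exact (hff _ _).2 hxy
    · intro y
      obtain ⟨k, rfl⟩ := hf' y
      exact ⟨f k, hτ k⟩
  refine ⟨π, hπ, Equiv.ofBijective _ hbij, ?_⟩
  intro x y i
  simp only [Equiv.ofBijective_apply]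
  rw [harc, harc']
  have hx : ∀ (x : V) (k : ℕ), x = f k ↔ f' (r x) = f' k := fun x k => by
    rw [← hff, hr]
  simp only [hx, cyc_map π hw, ← hπ4, π.injective.eq_iff]

theorem IsExtractedFrom.isOfWord {V : Type*} {Φ : DirectionGraph V} {p q : ℤ} {l : List Square}
    {C : (leaperGraph p q).Subgraph} {w : List (Fin 8)} (hp : 0 < p) (hq : p < q)
    (hΦ : IsExtractedFrom Φ C) (hC : IsCycleThrough l C) (hw : Follows (dirVec p q) l w) :
    Φ.IsOfWord w := by
  have h3 := hC.three_le
  have h0 : l ≠ [] := by rintro rfl; simp at h3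
  have hmem : ∀ k, cyc l k ∈ C.verts := fun k => hC.mem_verts.2 (cyc_mem h0 k)
  obtain ⟨σ, hσ⟩ := hΦ
  have hi : ∀ i k, IsMoveOfDirection p q i (cyc l (k + 1) - cyc l k) ↔ i = cyc w k := fun i k => by
    rw [isMoveOfDirection_iff, hw.step, add_sub_cancel_left,
      (dirVec_injective hp hq).eq_iff, eq_comm]
  have hi' : ∀ i k, IsMoveOfDirection p q i (cyc l k - cyc l (k + 1)) ↔ i = cyc w k + 4 :=
    fun i k => by
      rw [isMoveOfDirection_iff, hw.step, sub_add_cancel_left, ← dirVec_antipode,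
        (dirVec_injective hp hq).eq_iff, eq_comm]
  refine ⟨?_, fun k => σ ⟨cyc l k, hmem k⟩, ?_, ?_, ?_⟩
  · rintro rfl
    have := hw.length_eq
    simp at this
    omega
  · intro x
    obtain ⟨⟨a, ha⟩, rfl⟩ := σ.surjective x
    obtain ⟨k, rfl⟩ := (mem_iff_exists_cyc h0).1 (hC.mem_verts.1 ha)
    exact ⟨k, rfl⟩
  · intro j k
    rw [σ.injective.eq_iff, Subtype.mk.injEq, cyc_inj hC.nodup h0, hw.length_eq]
  · intro x y i
    obtain ⟨a, rfl⟩ := σ.surjective x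
    obtain ⟨b, rfl⟩ := σ.surjective y
    rw [← hσ, hC.adj_iff, ← exists_and_right]
    refine exists_congr fun k => ?_
    simp only [σ.injective.eq_iff, Subtype.ext_iff]
    constructor
    · rintro ⟨⟨ha, hb⟩ | ⟨ha, hb⟩, hm⟩
      · rw [ha, hb, hi] at hm
        exact Or.inl ⟨ha, hb, hm⟩
      · rw [ha, hb, hi'] at hm
        exact Or.inr ⟨ha, hb, hm⟩
    · rintro (⟨ha, hb, hm⟩ | ⟨ha, hb, hm⟩)
      · refine ⟨Or.inl ⟨ha, hb⟩, ?_⟩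
        rwa [ha, hb, hi]
      · refine ⟨Or.inr ⟨ha, hb⟩, ?_⟩
        rwa [ha, hb, hi']

/-- Partial sums of the direction matrices along the word form a potential on the vertices, well
defined because the total is zero. Every arc label is a potential difference, so the sum over any
closed sequence of arcs telescopes. -/
theorem exists_directionGraph {p q : ℤ} {l : List Square}
    {C : (leaperGraph p q).Subgraph} {w : List (Fin 8)} (hp : 0 < p) (hq : p < q)
    (hC : IsCycleThrough l C) (hw : Follows (dirVec p q) l w) (h0 : matrixSum w = 0) :
    ∃ (V : Type) (Φ : DirectionGraph V), IsExtractedFrom Φ C := by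
  have h3 := hC.three_le
  have hl : l ≠ [] := by rintro rfl; simp at h3
  have hwl := hw.length_eq
  have hr : ∀ a : C.verts, ∃ k, cyc l k = a := fun a =>
    (mem_iff_exists_cyc hl).1 (hC.mem_verts.1 a.2)
  choose r hr using hr
  let ψ : ℕ → Matrix (Fin 2) (Fin 2) ℤ := fun k => matrixSum (w.take (k % w.length))
  have hψ : ∀ k, ψ (k + 1) = ψ k + dirMatrix (cyc w k) := by
    intro k
    have hk : k % w.length < w.length := Nat.mod_lt _ (by omega)
    have e : matrixSum (w.take (k % w.length + 1)) = ψ k + dirMatrix (cyc w k) := by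
      rw [List.take_succ_eq_append_getElem hk, matrixSum_append, ← cyc_mod, cyc_of_lt hk]
      simp [matrixSum, ψ]
    rw [← e]
    simp only [ψ]
    by_cases hlt : k % w.length + 1 < w.length
    · rw [Nat.add_mod, Nat.mod_eq_of_lt (by omega : 1 < w.length), Nat.mod_eq_of_lt hlt]
    · have : k % w.length + 1 = w.length := by omega
      rw [Nat.add_mod, Nat.mod_eq_of_lt (by omega : 1 < w.length), this, Nat.mod_self,
        List.take_length, h0]
      simp [matrixSum]
  have hψc : ∀ j k, cyc l j = cyc l k → ψ j = ψ k := by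
    intro j k h
    rw [cyc_inj hC.nodup hl, ← hwl] at h
    simp only [ψ, h]
  have harc : ∀ (a b : C.verts) i, C.Adj a b → IsMoveOfDirection p q i ((b : Square) - a) →
      ψ (r b) - ψ (r a) = dirMatrix i := by
    intro a b i hab hi
    obtain ⟨k, ⟨ha, hb⟩ | ⟨ha, hb⟩⟩ := hC.adj_iff.1 hab
    · rw [hψc (r a) k (by rw [hr, ha]), hψc (r b) (k + 1) (by rw [hr, hb]), hψ]
      rw [isMoveOfDirection_iff, ha, hb, hw.step, add_sub_cancel_left,
        (dirVec_injective hp hq).eq_iff] at hi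
      rw [hi]
      abel
    · rw [hψc (r a) (k + 1) (by rw [hr, ha]), hψc (r b) k (by rw [hr, hb]), hψ]
      rw [isMoveOfDirection_iff, ha, hb, hw.step, sub_add_cancel_left, ← dirVec_antipode,
        (dirVec_injective hp hq).eq_iff] at hi
      rw [← hi, dirMatrix_antipode]
      abel
  refine ⟨C.verts, ⟨fun a b i => C.Adj a b ∧ IsMoveOfDirection p q i ((b : Square) - a), ?_, ?_⟩,
    Equiv.refl _, fun a b i => Iff.rfl⟩
  · rintro a b i ⟨hab, hi⟩
    refine ⟨i + 4, hab.symm, ?_⟩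
    rw [isMoveOfDirection_iff] at hi ⊢
    rw [dirVec_antipode, ← hi]
    abel
  · intro n x s _ h
    have : ∀ k, dirMatrix (s k) = ψ (r (x (k + 1))) - ψ (r (x k)) := fun k =>
      (harc _ _ _ (h k).1 (h k).2).symm
    simp only [this, Finset.sum_sub_distrib]
    rw [sub_eq_zero]
    -- The heads of the arcs are their tails shifted cyclically by one, so both have the same total
    -- potential.
    exact Equiv.sum_comp (Equiv.addRight (1 : Fin (n + 1))) fun k => ψ (r (x k))

/-! ## Cycles on the board -/

theorem mem_board_iff {F : ℤ × ℤ} {s : Square} : s ∈ board F ↔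
    (-(F.1 + F.2) < 2 * s.1 ∧ 2 * s.1 < F.1 + F.2) ∧
      -(F.1 + F.2) < 2 * s.2 ∧ 2 * s.2 < F.1 + F.2 := by
  simp only [board, Set.mem_ofPred_eq, abs_lt]

/-- In one coordinate, a step of length `q` can stay on the board only if it starts in an outer band
and points inward, and a step of length `p` from an outer band must also point inward. Corners and
sides thus leave two directions each. -/
theorem exists_two_directions {p q : ℤ} (hq : p < q) {x : Square} :
    ∃ i j : Fin 8, ∀ d, x + dirVec p q d ∈ board (p, q) → d = i ∨ d = j := by
  obtain ⟨a, b⟩ := x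
  have key : ∀ i j : Fin 8, (∀ d, d ≠ i → d ≠ j → (a, b) + dirVec p q d ∉ board (p, q)) →
      ∃ i j : Fin 8, ∀ d, (a, b) + dirVec p q d ∈ board (p, q) → d = i ∨ d = j := by
    intro i j h
    refine ⟨i, j, fun d hd => ?_⟩
    by_contra hne
    rw [not_or] at hne
    exact h d hne.1 hne.2 hd
  rcases lt_or_ge (2 * a) (p - q) with ha | ha
  · rcases lt_or_ge (2 * b) (p - q) with hb | hb
    · apply key 0 1
      intro d h1 h2 h; rw [mem_board_iff] at h
      fin_cases d <;> simp [dirVec] at h1 h2 h <;> omega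
    · rcases lt_or_ge (q - p) (2 * b) with hb' | hb'
      · apply key 6 7
        intro d h1 h2 h; rw [mem_board_iff] at h
        fin_cases d <;> simp [dirVec] at h1 h2 h <;> omega
      · apply key 0 7
        intro d h1 h2 h; rw [mem_board_iff] at h
        fin_cases d <;> simp [dirVec] at h1 h2 h <;> omega
  · rcases lt_or_ge (q - p) (2 * a) with ha' | ha'
    · rcases lt_or_ge (2 * b) (p - q) with hb | hb
      · apply key 2 3
        intro d h1 h2 h; rw [mem_board_iff] at h
        fin_cases d <;> simp [dirVec] at h1 h2 h <;> omega
      · rcases lt_or_ge (q - p) (2 * b) with hb' | hb'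
        · apply key 4 5
          intro d h1 h2 h; rw [mem_board_iff] at h
          fin_cases d <;> simp [dirVec] at h1 h2 h <;> omega
        · apply key 3 4
          intro d h1 h2 h; rw [mem_board_iff] at h
          fin_cases d <;> simp [dirVec] at h1 h2 h <;> omega
    · rcases lt_or_ge (2 * b) (p - q) with hb | hb
      · apply key 1 2
        intro d h1 h2 h; rw [mem_board_iff] at h
        fin_cases d <;> simp [dirVec] at h1 h2 h <;> omega
      -- This case covers the central hole as well as the northern side; no move from the hole stays
      -- on the board, so any two directions serve there.
      · apply key 5 6
        intro d h1 h2 h; rw [mem_board_iff] at h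
        fin_cases d <;> simp [dirVec] at h1 h2 h <;> omega

theorem IsCycle.exists_isCycleThrough {p q : ℤ} {C : (leaperGraph p q).Subgraph}
    (h : IsCycle C) : ∃ l, IsCycleThrough l C := by
  obtain ⟨a, w, hw, hC⟩ := h
  exact ⟨_, a, w, hw, rfl, hC⟩

/-- Every square of a cycle on the board is adjacent in the cycle to all squares of the board
that are a move away from it. -/
theorem IsCycle.adj_of_mem_board {p q : ℤ} (hp : 0 < p) (hq : p < q)
    {C : (leaperGraph p q).Subgraph} (hC : IsCycle C) (hb : C.verts ⊆ board (p, q))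
    {x y : Square} (hx : x ∈ C.verts) (hy : y ∈ board (p, q))
    (hxy : (leaperGraph p q).Adj x y) : C.Adj x y := by
  obtain ⟨a, w, hw, rfl⟩ := hC
  have h2 := hw.ncard_neighborSet_toSubgraph_eq_two
    ((SimpleGraph.Walk.mem_verts_toSubgraph w).1 hx)
  obtain ⟨i, j, hij⟩ := exists_two_directions hq (x := x)
  have hmem : ∀ z ∈ board (p, q), (leaperGraph p q).Adj x z →
      z ∈ ({x + dirVec p q i, x + dirVec p q j} : Set Square) := by
    intro z hz hxz
    obtain ⟨d, rfl⟩ := (leaperGraph_adj_iff hp hq).1 hxz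
    rcases hij d hz with rfl | rfl <;> simp
  have hsub : w.toSubgraph.neighborSet x ⊆ {x + dirVec p q i, x + dirVec p q j} := by
    intro z hz
    exact hmem z (hb (w.toSubgraph.edge_vert hz.symm)) hz.adj_sub
  -- The cycle already uses two neighbours, hence all the candidates.
  have heq := Set.eq_of_subset_of_ncard_le hsub (by
    rw [h2]
    simpa using Set.ncard_insert_le (x + dirVec p q i) {x + dirVec p q j})
  have := hmem y hy hxy
  rwa [← heq] at this

/-- Starting from the common square, `C` is forced to contain each next square of `C'`. -/
theorem IsCycle.verts_subset {p q : ℤ} (hp : 0 < p) (hq : p < q)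
    {C C' : (leaperGraph p q).Subgraph} (hC : IsCycle C) (hC' : IsCycle C')
    (hb : C.verts ⊆ board (p, q)) (hb' : C'.verts ⊆ board (p, q))
    {x : Square} (hx : x ∈ C.verts) (hx' : x ∈ C'.verts) : C'.verts ⊆ C.verts := by
  obtain ⟨l, hl⟩ := hC'.exists_isCycleThrough
  have h3 := hl.three_le
  have h0 : l ≠ [] := by rintro rfl; simp at h3
  obtain ⟨j, rfl⟩ := (mem_iff_exists_cyc h0).1 (hl.mem_verts.1 hx')
  have step : ∀ k, cyc l (j + k) ∈ C.verts := by
    intro k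
    induction k with
    | zero => exact hx
    | succ k ih =>
      have hadj : C'.Adj (cyc l (j + k)) (cyc l (j + k + 1)) := hl.adj_iff.2 ⟨j + k, by simp⟩
      have := hC.adj_of_mem_board hp hq hb ih (hb' (C'.edge_vert hadj.symm)) hadj.adj_sub
      exact C.edge_vert this.symm
  intro y hy
  obtain ⟨k, rfl⟩ := (mem_iff_exists_cyc h0).1 (hl.mem_verts.1 hy)
  -- The multiple of `l.length - 1` undoes the offset `j` modulo the length.
  have := step (k + j * (l.length - 1))
  rwa [cyc_congr (k := k)] at this
  have : j + (k + j * (l.length - 1)) = k + j * l.length := by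
    obtain ⟨m, hm⟩ := Nat.exists_eq_add_of_lt (show 0 < l.length by omega)
    rw [hm]
    simp
    ring
  rw [this]
  simp

/-- Two cycles on the board that share a square coincide. -/
theorem IsCycle.eq_of_mem {p q : ℤ} (hp : 0 < p) (hq : p < q)
    {C C' : (leaperGraph p q).Subgraph} (hC : IsCycle C) (hC' : IsCycle C')
    (hb : C.verts ⊆ board (p, q)) (hb' : C'.verts ⊆ board (p, q))
    {x : Square} (hx : x ∈ C.verts) (hx' : x ∈ C'.verts) : C = C' := by
  have hv : C.verts = C'.verts :=
    (hC'.verts_subset hp hq hC hb' hb hx' hx).antisymm (hC.verts_subset hp hq hC' hb hb' hx hx')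
  refine SimpleGraph.Subgraph.ext hv ?_
  ext a b
  constructor
  · intro h
    exact hC'.adj_of_mem_board hp hq hb' (hv ▸ C.edge_vert h)
      (hb (C.edge_vert h.symm)) h.adj_sub
  · intro h
    exact hC.adj_of_mem_board hp hq hb (hv ▸ C'.edge_vert h)
      (hb' (C'.edge_vert h.symm)) h.adj_sub

/-! ## Sections and liftings -/

theorem isSkewBasic_liftFrame (t : Letter) {F : ℤ × ℤ} (h : IsSkewBasic F.1 F.2) :
    IsSkewBasic (liftFrame t F).1 (liftFrame t F).2 := by
  obtain ⟨m, n⟩ := F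
  obtain ⟨h1, h2, ⟨k, h3⟩, ⟨a, b, h4⟩⟩ := h
  simp only at h1 h2 h3 h4
  cases t
  · refine ⟨h1, ?_, ?_, ?_⟩
    · simp [liftFrame]; omega
    · exact ⟨k + m, by simp [liftFrame]; omega⟩
    -- Bézout coefficients of the lifted pair, from `a * m + b * n = 1`.
    · refine ⟨a - 2 * b, b, ?_⟩
      simp only [liftFrame]
      linear_combination h4
  · refine ⟨?_, ?_, ?_, ?_⟩
    · simp [liftFrame]; omega
    · simp [liftFrame]; omega
    · exact ⟨k + n - m, by simp [liftFrame]; omega⟩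
    · refine ⟨b + 2 * a, -a, ?_⟩
      simp only [liftFrame]
      linear_combination h4
  · refine ⟨?_, ?_, ?_, ?_⟩
    · simp [liftFrame]; omega
    · simp [liftFrame]; omega
    · exact ⟨k + n, by simp [liftFrame]; omega⟩
    · refine ⟨b - 2 * a, a, ?_⟩
      simp only [liftFrame]
      linear_combination h4

theorem isSkewBasic_liftFrameSeq (e : List Letter) {F : ℤ × ℤ} (h : IsSkewBasic F.1 F.2) :
    IsSkewBasic (liftFrameSeq e F).1 (liftFrameSeq e F).2 := by
  induction e with
  | nil => exact h
  | cons t e ih => exact isSkewBasic_liftFrame t ih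

theorem isSkewBasic_one_two : IsSkewBasic 1 2 :=
  ⟨by decide, by decide, by decide, ⟨1, 0, by decide⟩⟩

theorem inBand_zero {F : ℤ × ℤ} {x : ℤ} :
    InBand F 0 x ↔ -(F.2 - F.1) < 2 * x ∧ 2 * x < F.2 - F.1 := by
  simp only [InBand, if_true, abs_lt]

theorem inBand_one {F : ℤ × ℤ} {x : ℤ} :
    InBand F 1 x ↔ F.2 - F.1 < 2 * x ∧ 2 * x < F.1 + F.2 := by
  simp [InBand]

theorem inBand_neg_one {F : ℤ × ℤ} {x : ℤ} :
    InBand F (-1) x ↔ F.2 - F.1 < 2 * (-x) ∧ 2 * (-x) < F.1 + F.2 := by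
  simp [InBand]

theorem frameSection_injective {F : ℤ × ℤ} (hF : F.1 < F.2) {s : Square} {i j : Fin 8}
    (hi : s ∈ frameSection F i) (hj : s ∈ frameSection F j) : i = j := by
  have key : ∀ {c d x : ℤ}, c = 0 ∨ c = 1 ∨ c = -1 → d = 0 ∨ d = 1 ∨ d = -1 →
      InBand F c x → InBand F d x → c = d := by
    rintro c d x (rfl | rfl | rfl) (rfl | rfl | rfl) h h' <;>
      simp [inBand_zero, inBand_one, inBand_neg_one] at h h' ⊢ <;> omega
  have h1 : ∀ i, (compass i).1 = 0 ∨ (compass i).1 = 1 ∨ (compass i).1 = -1 := by decide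
  have h2 : ∀ i, (compass i).2 = 0 ∨ (compass i).2 = 1 ∨ (compass i).2 = -1 := by decide
  have e1 := key (h1 i) (h1 j) hi.1 hj.1
  have e2 := key (h2 i) (h2 j) hi.2 hj.2
  have : Function.Injective compass := by decide
  exact this (Prod.ext e1 e2)

theorem frameSection_subset_board {F : ℤ × ℤ} (h1 : 0 < F.1) (h2 : F.1 < F.2) (i : Fin 8) :
    frameSection F i ⊆ board F := by
  have key : ∀ {c x : ℤ}, c = 0 ∨ c = 1 ∨ c = -1 → InBand F c x →
      -(F.1 + F.2) < 2 * x ∧ 2 * x < F.1 + F.2 := by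
    rintro c x (rfl | rfl | rfl) h <;>
    simp [inBand_zero, inBand_one, inBand_neg_one] at h ⊢ <;> omega
  have e1 : ∀ i, (compass i).1 = 0 ∨ (compass i).1 = 1 ∨ (compass i).1 = -1 := by decide
  have e2 : ∀ i, (compass i).2 = 0 ∨ (compass i).2 = 1 ∨ (compass i).2 = -1 := by decide
  exact fun s hs => mem_board_iff.2 ⟨key (e1 i) hs.1, key (e2 i) hs.2⟩

set_option maxHeartbeats 1000000 in
/-- Which translates of a square of the section `j` stay in the sections they point to. -/
theorem add_liftVector_mem_iff (t : Letter) {F : ℤ × ℤ} (h1 : 0 < F.1) (h2 : F.1 < F.2)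
    {s : Square} {j : Fin 8} (hs : s ∈ frameSection F j) (i : Fin 8) :
    s + liftVector t F i ∈ frameSection (liftFrame t F) i ↔
      i ∈ (liftTypePos t j).map Prod.fst := by
  obtain ⟨m, n⟩ := F
  obtain ⟨a, b⟩ := s
  simp only at h1 h2
  cases t
  all_goals
    fin_cases j <;> fin_cases i <;>
    simp [frameSection, inBand_zero, inBand_one, inBand_neg_one, compass, liftVector,
      liftLengths, liftFrame, liftTypePos] at hs ⊢ <;> omega

/-! ## Liftings of the first leaper cycle -/

/-- The lifts of a square with a type. -/
def liftLabelled (t : Letter) (F : ℤ × ℤ) (x : Square × VertexType) :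
    List (Square × VertexType) :=
  (liftType t x.2).map fun σ => (x.1 + liftVector t F σ.1, σ)

/-- Lift a list of squares with types successively by `e_l, …, e_1`. -/
def liftLabelledSeq : List Letter → ℤ × ℤ → List (Square × VertexType) →
    List (Square × VertexType)
  | [], _, l => l
  | t :: e, F, l => (liftLabelledSeq e F l).flatMap (liftLabelled t (liftFrameSeq e F))

/-- The next move from the square `x` leads to the square `y`. -/
def Precedes (F : ℤ × ℤ) (x y : Square × VertexType) : Prop :=
  y.1 = x.1 + dirVec F.1 F.2 (outDir x.2) ∧ inDir y.2 = outDir x.2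

/-- The list `l` goes around a cycle of the leaper of the frame `F`, within the sections of `F`. -/
structure IsLabelledCycle (F : ℤ × ℤ) (l : List (Square × VertexType)) : Prop where
  three_le : 3 ≤ l.length
  mem_section : ∀ x ∈ l, x.1 ∈ frameSection F x.2.1
  nodup : (l.map Prod.fst).Nodup
  chain : (l ++ l).IsChain (Precedes F)

theorem liftType_ne_nil (t : Letter) (τ : VertexType) : liftType t τ ≠ [] := by
  cases t <;> revert τ <;> decide

theorem mem_map_fst_liftType (t : Letter) (τ : VertexType) (i : Fin 8) :
    i ∈ (liftType t τ).map Prod.fst ↔ i ∈ (liftTypePos t τ.1).map Prod.fst := by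
  cases t <;> revert τ i <;> decide

theorem nodup_map_fst_liftType (t : Letter) (τ : VertexType) :
    ((liftType t τ).map Prod.fst).Nodup := by
  cases t <;> revert τ <;> decide

/-- All lifts of one square differ by differences of lifting vectors; in the listed order these are
moves of the larger leaper, in the directions that the types announce. -/
theorem isChain_liftLabelled (t : Letter) (F : ℤ × ℤ) (x : Square × VertexType) :
    (liftLabelled t F x).IsChain (Precedes (liftFrame t F)) := by
  obtain ⟨⟨a, b⟩, i, c⟩ := x
  obtain ⟨m, n⟩ := F
  cases t <;> fin_cases i <;> cases c <;>
    simp [liftLabelled, liftType, liftTypePos, Precedes, outDir, inDir, dirVec, liftFrame,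
      liftVector, liftLengths, compass, -zsmul_eq_mul] <;> omega

theorem eq_of_inDir_eq {σ : VertexType} {o : Fin 8} (h : inDir σ = o) :
    σ = (o, true) ∨ σ = (o + 1, false) := by
  obtain ⟨i, b⟩ := σ
  subst h
  revert i b
  decide

/-- A move of the smaller leaper plus a difference of lifting vectors is a move of the larger
leaper. The type of the second square is known up to two cases from the direction by which it is
entered, so finitely many identities suffice. -/
theorem precedes_liftLabelled (t : Letter) (F : ℤ × ℤ) {x y : Square × VertexType}
    (h : Precedes F x y) : ∀ x' ∈ (liftLabelled t F x).getLast?,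
      ∀ y' ∈ (liftLabelled t F y).head?, Precedes (liftFrame t F) x' y' := by
  obtain ⟨⟨a, b⟩, i, c⟩ := x
  obtain ⟨y, σ⟩ := y
  obtain ⟨m, n⟩ := F
  obtain ⟨h1, h2⟩ := h
  simp only at h1 h2
  subst h1
  rcases eq_of_inDir_eq h2 with rfl | rfl <;> clear h2 <;>
  cases t <;> fin_cases i <;> cases c <;>
    simp [liftLabelled, liftType, liftTypePos, Precedes, outDir, inDir, dirVec, liftFrame,
      liftVector, liftLengths, compass, -zsmul_eq_mul] <;> omega

theorem IsLabelledCycle.lift (t : Letter) {F : ℤ × ℤ} {l : List (Square × VertexType)}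
    (h : IsLabelledCycle F l) (h1 : 0 < F.1) (h2 : F.1 < F.2)
    (h2' : (liftFrame t F).1 < (liftFrame t F).2) :
    IsLabelledCycle (liftFrame t F) (l.flatMap (liftLabelled t F)) := by
  have hmem : ∀ x ∈ l, ∀ σ ∈ liftType t x.2,
      x.1 + liftVector t F σ.1 ∈ frameSection (liftFrame t F) σ.1 := fun x hx σ hσ =>
    (add_liftVector_mem_iff t h1 h2 (h.mem_section x hx) σ.1).2
      ((mem_map_fst_liftType t x.2 σ.1).1 (List.mem_map_of_mem hσ))
  refine ⟨h.three_le.trans ?_, ?_, ?_, ?_⟩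
  · have hpos : ∀ x, 1 ≤ (liftLabelled t F x).length := fun x => by
      rw [liftLabelled, List.length_map]
      exact List.length_pos_iff.2 (liftType_ne_nil t x.2)
    clear h hmem
    induction l with
    | nil => simp
    | cons x l ih =>
      have := hpos x
      simp only [List.flatMap_cons, List.length_append, List.length_cons]
      omega
  · intro y hy
    obtain ⟨x, hx, hy⟩ := List.mem_flatMap.1 hy
    obtain ⟨σ, hσ, rfl⟩ := List.mem_map.1 hy
    exact hmem x hx σ hσ
  -- Coinciding lifts lie in one section of the larger frame, so they use the same lifting vector
  -- and come from the same square.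
  · rw [List.map_flatMap, List.nodup_flatMap]
    constructor
    · intro x hx
      rw [liftLabelled, List.map_map]
      have hn := nodup_map_fst_liftType t x.2
      refine (List.Nodup.of_map _ hn).map_on ?_
      intro σ hσ σ' hσ' e
      have h3 := hmem x hx σ hσ
      have e' : x.1 + liftVector t F σ.1 = x.1 + liftVector t F σ'.1 := e
      rw [e'] at h3
      exact List.inj_on_of_nodup_map hn hσ hσ'
        (frameSection_injective h2' h3 (hmem x hx σ' hσ'))
    · refine ((List.pairwise_map.1 h.nodup).imp_of_mem ?_)
      intro x x' hx hx' hne y hy hy'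
      simp only [liftLabelled, List.map_map, List.mem_map, Function.comp_apply] at hy hy'
      obtain ⟨σ, hσ, rfl⟩ := hy
      obtain ⟨σ', hσ', e⟩ := hy'
      have h3 := hmem x hx σ hσ
      rw [← e] at h3
      rw [frameSection_injective h2' h3 (hmem x' hx' σ' hσ')] at e
      exact hne (add_right_cancel e).symm
  -- Doubling the list turns the closing move into an ordinary link, so it suffices to check the
  -- links within blocks and between consecutive blocks.
  · rw [← List.flatMap_append, List.flatMap_def, List.isChain_flatten]
    · constructor
      · intro l' hl'
        obtain ⟨x, -, rfl⟩ := List.mem_map.1 hl'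
        exact isChain_liftLabelled t F x
      · rw [List.isChain_map]
        exact h.chain.imp fun _ _ hxy => precedes_liftLabelled t F hxy
    · intro hn
      obtain ⟨x, -, hx⟩ := List.mem_map.1 hn
      exact liftType_ne_nil t x.2 (List.map_eq_nil_iff.1 hx)

theorem IsLabelledCycle.liftSeq (e : List Letter) {F : ℤ × ℤ} {l : List (Square × VertexType)}
    (h : IsLabelledCycle F l) (hF : IsSkewBasic F.1 F.2) :
    IsLabelledCycle (liftFrameSeq e F) (liftLabelledSeq e F l) := by
  induction e with
  | nil => exact h
  | cons t e ih =>
    have h' := isSkewBasic_liftFrameSeq e hF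
    exact ih.lift t h'.pos h'.lt (isSkewBasic_liftFrame t h').lt

theorem IsLabelledCycle.follows {F : ℤ × ℤ} {l : List (Square × VertexType)}
    (h : IsLabelledCycle F l) :
    Follows (dirVec F.1 F.2) (l.map Prod.fst) ((l.map Prod.snd).map outDir) := by
  have h3 := h.three_le
  have h0 : l ≠ [] := by rintro rfl; simp at h3
  refine ⟨by simp, fun k => ?_⟩
  rw [cyc_map _ h0, cyc_map _ h0, cyc_map _ (by simpa using h0), cyc_map _ h0]
  have key : ∀ j (hj : j < (l ++ l).length), (l ++ l)[j] = cyc l j := by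
    intro j hj
    rw [List.getElem_append]
    split
    · next hlt => rw [cyc_of_lt hlt]
    · next hge =>
      rw [List.length_append] at hj
      have := cyc_congr (l := l) (j := j) (k := j - l.length) (by
        conv_lhs => rw [← Nat.sub_add_cancel (not_lt.1 hge)]
        simp)
      rw [this, cyc_of_lt (by omega)]
  have hk : k % l.length < l.length := Nat.mod_lt _ (by omega)
  have := List.isChain_iff_getElem.1 h.chain (k % l.length) (by simp; omega)
  rw [key, key, cyc_mod, cyc_congr (j := k % l.length + 1) (k := k + 1) (by simp)] at this
  exact this.1

/-- Types evolve independently of positions; hence the word depends on `e` alone, not on the frame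
or the chosen shell cycle. -/
theorem map_snd_liftLabelledSeq (e : List Letter) (F : ℤ × ℤ) (l : List (Square × VertexType)) :
    (liftLabelledSeq e F l).map Prod.snd = (l.map Prod.snd).flatMap (liftTypeSeq e) := by
  induction e with
  | nil => simp [liftLabelledSeq, liftTypeSeq]
  | cons t e ih =>
    simp only [liftLabelledSeq, liftTypeSeq]
    rw [← List.flatMap_assoc, ← ih, List.map_flatMap, List.flatMap_map]
    refine List.flatMap_congr fun x _ => ?_
    simp [liftLabelled, Function.comp_def]

theorem mem_liftSet {t : Letter} {F : ℤ × ℤ} {S : Set Square} {y : Square} :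
    y ∈ liftSet t F S ↔
      ∃ s ∈ S, ∃ i, y = s + liftVector t F i ∧ y ∈ frameSection (liftFrame t F) i := by
  simp only [liftSet, Set.mem_iUnion, Set.mem_inter_iff, Set.mem_image]
  constructor
  · rintro ⟨i, ⟨s, hs, rfl⟩, hi⟩
    exact ⟨s, hs, i, rfl, hi⟩
  · rintro ⟨s, hs, i, rfl, hi⟩
    exact ⟨i, ⟨s, hs, rfl⟩, hi⟩

theorem IsLabelledCycle.mem_lift_iff (t : Letter) {F : ℤ × ℤ} {l : List (Square × VertexType)}
    (h : IsLabelledCycle F l) (h1 : 0 < F.1) (h2 : F.1 < F.2) (y : Square) :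
    y ∈ (l.flatMap (liftLabelled t F)).map Prod.fst ↔
      y ∈ liftSet t F {s | s ∈ l.map Prod.fst} := by
  simp only [mem_liftSet, List.map_flatMap, List.mem_flatMap, Set.mem_ofPred_eq, List.mem_map,
    liftLabelled]
  constructor
  · rintro ⟨x, hx, _, ⟨σ, hσ, rfl⟩, rfl⟩
    exact ⟨_, ⟨x, hx, rfl⟩, σ.1, rfl, (add_liftVector_mem_iff t h1 h2 (h.mem_section x hx) σ.1).2
      ((mem_map_fst_liftType t x.2 σ.1).1 (List.mem_map_of_mem hσ))⟩
  · rintro ⟨_, ⟨x, hx, rfl⟩, i, rfl, hi⟩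
    rw [add_liftVector_mem_iff t h1 h2 (h.mem_section x hx), ← mem_map_fst_liftType] at hi
    obtain ⟨σ, hσ, rfl⟩ := List.mem_map.1 hi
    exact ⟨x, hx, _, ⟨σ, hσ, rfl⟩, rfl⟩

theorem IsLabelledCycle.mem_liftSeq_iff (e : List Letter) {F : ℤ × ℤ}
    {l : List (Square × VertexType)} (h : IsLabelledCycle F l) (hF : IsSkewBasic F.1 F.2) :
    {s | s ∈ (liftLabelledSeq e F l).map Prod.fst} =
      liftSetSeq e F {s | s ∈ l.map Prod.fst} := by
  induction e with
  | nil => rfl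
  | cons t e ih =>
    have h' := isSkewBasic_liftFrameSeq e hF
    rw [liftSetSeq, ← ih]
    ext y
    exact (h.liftSeq e hF).mem_lift_iff t h'.pos h'.lt y

/-! ## Shell cycles -/

/-- The centre of the square of the shell in the direction `i`. -/
def shellCenter (F : ℤ × ℤ) (i : Fin 8) : Square :=
  (if i.val % 2 = 0 then F.2 - F.1 else F.1) • compass i

/-- The squares of a shell cycle, in cyclic order, with their types. -/
def shellLabelled (F : ℤ × ℤ) (d : Square) : List (Square × VertexType) :=
  shellTypes.map fun τ => (shellCenter F τ.1 + d, τ)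

theorem isLabelledCycle_shellLabelled {F : ℤ × ℤ} (hF : F.1 < F.2) {d : Square}
    (h : ∀ i, shellCenter F i + d ∈ frameSection F i) :
    IsLabelledCycle F (shellLabelled F d) := by
  refine ⟨by simp [shellLabelled, shellTypes], ?_, ?_, ?_⟩
  · intro x hx
    obtain ⟨τ, -, rfl⟩ := List.mem_map.1 hx
    exact h τ.1
  · rw [shellLabelled, List.map_map]
    have hn : (shellTypes.map Prod.fst).Nodup := by decide
    refine (List.Nodup.of_map _ hn).map_on ?_
    intro σ hσ σ' hσ' e
    have h3 := h σ.1
    have e' : shellCenter F σ.1 + d = shellCenter F σ'.1 + d := e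
    rw [e'] at h3
    exact List.inj_on_of_nodup_map hn hσ hσ' (frameSection_injective hF h3 (h σ'.1))
  · obtain ⟨a, b⟩ := d
    obtain ⟨m, n⟩ := F
    simp [shellLabelled, shellTypes, Precedes, shellCenter, compass, dirVec, outDir, inDir,
      -zsmul_eq_mul]
    omega

theorem mem_shellLabelled {F : ℤ × ℤ} {d : Square} :
    {s | s ∈ (shellLabelled F d).map Prod.fst} = Set.range fun i => shellCenter F i + d := by
  ext s
  simp only [shellLabelled, List.map_map, Set.mem_ofPred_eq, List.mem_map, Function.comp_apply,
    Set.mem_range]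
  constructor
  · rintro ⟨τ, -, rfl⟩
    exact ⟨τ.1, rfl⟩
  · rintro ⟨i, rfl⟩
    have : ∀ i, ((i, true) : VertexType) ∈ shellTypes := by decide
    exact ⟨(i, true), this i, rfl⟩

/-- The lift by `e` of a shell cycle. -/
theorem exists_list_liftSetSeq (e : List Letter) {F : ℤ × ℤ} (hF : IsSkewBasic F.1 F.2)
    {d : Square} (h : ∀ i, shellCenter F i + d ∈ frameSection F i) :
    ∃ (l : List Square) (C : (leaperGraph (liftFrameSeq e F).1 (liftFrameSeq e F).2).Subgraph),
      IsCycleThrough l C ∧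
      Follows (dirVec (liftFrameSeq e F).1 (liftFrameSeq e F).2) l (firstWord e) ∧
      C.verts = liftSetSeq e F (Set.range fun i => shellCenter F i + d) ∧
      C.verts ⊆ board (liftFrameSeq e F) := by
  have H := isLabelledCycle_shellLabelled hF.lt h
  have H' := H.liftSeq e hF
  have hG := isSkewBasic_liftFrameSeq e hF
  have hf := H'.follows
  obtain ⟨C, hC⟩ := exists_isCycleThrough H'.nodup (by simpa using H'.three_le)
    (fun k => (leaperGraph_adj_iff hG.pos hG.lt).2 ⟨_, hf.step k⟩)
  have hv : C.verts = {s | s ∈ (liftLabelledSeq e F (shellLabelled F d)).map Prod.fst} :=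
    Set.ext fun x => hC.mem_verts
  refine ⟨_, C, hC, ?_, ?_, ?_⟩
  · rw [map_snd_liftLabelledSeq] at hf
    have : (shellLabelled F d).map Prod.snd = shellTypes := by
      simp [shellLabelled, Function.comp_def]
    rwa [this] at hf
  · rw [hv, H.mem_liftSeq_iff e hF, mem_shellLabelled]
  · rw [hv]
    intro s hs
    obtain ⟨x, hx, rfl⟩ := List.mem_map.1 hs
    exact frameSection_subset_board hG.pos hG.lt _ (H'.mem_section x hx)

/-! ## Shell cycles are unique up to translation -/

theorem shellCenter_add_mem {F : ℤ × ℤ} (h2 : F.1 < F.2) {d : Square}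
    (hd₁ : |2 * d.1| < shellSize F) (hd₂ : |2 * d.2| < shellSize F) (i : Fin 8) :
    shellCenter F i + d ∈ frameSection F i := by
  obtain ⟨m, n⟩ := F
  obtain ⟨a, b⟩ := d
  rw [abs_lt] at hd₁ hd₂
  simp only [shellSize] at h2 hd₁ hd₂
  split_ifs at hd₁ hd₂ <;> fin_cases i <;>
    simp [frameSection, inBand_zero, inBand_one, inBand_neg_one, compass, shellCenter,
      -zsmul_eq_mul] <;> omega

theorem mem_shell_iff {F : ℤ × ℤ} {s : Square} : s ∈ shell F ↔
    ∃ i d, s = shellCenter F i + d ∧ |2 * d.1| < shellSize F ∧ |2 * d.2| < shellSize F := by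
  constructor
  · rintro ⟨i, h1, h2⟩
    refine ⟨i, s - shellCenter F i, by abel, ?_, ?_⟩
    · simpa [shellCenter, -zsmul_eq_mul, -mul_ite, -ite_mul, -ite_smul] using h1
    · simpa [shellCenter, -zsmul_eq_mul, -mul_ite, -ite_mul, -ite_smul] using h2
  · rintro ⟨i, d, rfl, h1, h2⟩
    refine ⟨i, ?_, ?_⟩
    · simpa [shellCenter, -zsmul_eq_mul, -mul_ite, -ite_mul, -ite_smul] using h1
    · simpa [shellCenter, -zsmul_eq_mul, -mul_ite, -ite_mul, -ite_smul] using h2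

theorem shell_subset_board {F : ℤ × ℤ} (h1 : 0 < F.1) (h2 : F.1 < F.2) : shell F ⊆ board F := by
  intro s hs
  obtain ⟨i, d, rfl, hd₁, hd₂⟩ := mem_shell_iff.1 hs
  exact frameSection_subset_board h1 h2 i (shellCenter_add_mem h2 hd₁ hd₂ i)

/-- One square of the cycle fixes the offset `d` from a shell centre. The explicit cycle of the
eight centres displaced by `d` shares that square, so rigidity on the board identifies the two. -/
theorem IsShellCycle.exists_verts_eq {F : ℤ × ℤ} (hF : IsSkewBasic F.1 F.2)
    {C : (leaperGraph F.1 F.2).Subgraph} (hC : IsShellCycle F C) :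
    ∃ d, C.verts = Set.range (fun i => shellCenter F i + d) ∧
      ∀ i, shellCenter F i + d ∈ frameSection F i := by
  obtain ⟨x, w, hw, hwC⟩ := hC.1
  have hx : x ∈ C.verts := by
    rw [← hwC, SimpleGraph.Walk.mem_verts_toSubgraph]
    exact w.start_mem_support
  obtain ⟨j, d, rfl, hd₁, hd₂⟩ := mem_shell_iff.1 (hC.2 hx)
  have hs := shellCenter_add_mem hF.lt hd₁ hd₂
  obtain ⟨l, C', hl, -, hv, hb⟩ := exists_list_liftSetSeq [] hF hs
  have hx' : shellCenter F j + d ∈ C'.verts := by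
    rw [hv]
    exact ⟨j, rfl⟩
  have := hC.1.eq_of_mem hF.pos hF.lt hl.isCycle (hC.2.trans (shell_subset_board hF.pos hF.lt)) hb
    hx hx'
  refine ⟨d, ?_, hs⟩
  rw [this, hv]
  rfl

theorem liftFrameSeq_append (e e' : List Letter) (F : ℤ × ℤ) :
    liftFrameSeq (e ++ e') F = liftFrameSeq e (liftFrameSeq e' F) := by
  simp [liftFrameSeq]

theorem IsCycleFromShell.exists_verts_eq {e rest : List Letter} {p q : ℤ}
    {C : (leaperGraph p q).Subgraph}
    {C₀ : (leaperGraph (liftFrameSeq rest (1, 2)).1 (liftFrameSeq rest (1, 2)).2).Subgraph}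
    (h : IsCycleFromShell e rest p q C C₀) :
    ∃ d, C₀.verts = Set.range (fun i => shellCenter (liftFrameSeq rest (1, 2)) i + d) ∧
      ∀ i, shellCenter (liftFrameSeq rest (1, 2)) i + d ∈
        frameSection (liftFrameSeq rest (1, 2)) i :=
  h.shellCycle.exists_verts_eq (isSkewBasic_liftFrameSeq rest (F := (1, 2)) isSkewBasic_one_two)

/-- A cycle of descent `e` follows the word of `e`. -/
theorem IsCycleFromShell.exists_follows {e rest : List Letter} {p q : ℤ}
    {C : (leaperGraph p q).Subgraph}
    {C₀ : (leaperGraph (liftFrameSeq rest (1, 2)).1 (liftFrameSeq rest (1, 2)).2).Subgraph}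
    (h : IsCycleFromShell e rest p q C C₀) :
    ∃ l, IsCycleThrough l C ∧ Follows (dirVec p q) l (firstWord e) := by
  obtain ⟨d, hv, hd⟩ := h.exists_verts_eq
  have hF := isSkewBasic_liftFrameSeq rest (F := (1, 2)) isSkewBasic_one_two
  obtain ⟨l, C', hl, hf, hv', hb⟩ := exists_list_liftSetSeq e hF hd
  have hpq := h.leaperDescent
  rw [IsLeaperDescent, liftFrameSeq_append, Prod.ext_iff] at hpq
  obtain ⟨rfl, rfl⟩ := hpq
  rw [← hv, ← h.lift] at hv'
  have h3 := hl.three_le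
  have hx : cyc l 0 ∈ C'.verts := hl.mem_verts.2 (cyc_mem (by rintro rfl; simp at h3) 0)
  -- The given cycle is only known by its square set; sharing one square with the explicit lift is
  -- enough to make them equal.
  have := h.cycle.eq_of_mem h.skewBasic.pos h.skewBasic.lt hl.isCycle h.onBoard hb
    (hv' ▸ hx) hx
  exact ⟨l, this ▸ hl, hf⟩

/-! ## Walks -/

section Walk

variable (v : Fin 8 → Square)

/-- The end of the walk that starts at `s` and follows the word `w`. -/
def walkEnd (s : Square) (w : List (Fin 8)) : Square := s + (w.map v).sum

/-- The squares of the walk that starts at `s` and follows the word `w`, without its end. -/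
def stepList : Square → List (Fin 8) → List Square
  | _, [] => []
  | s, k :: w => s :: stepList (s + v k) w

/-- The squares of the walk that starts at `s` and follows the word `w`. -/
def walkList (s : Square) (w : List (Fin 8)) : List Square := stepList v s w ++ [walkEnd v s w]

theorem walkEnd_append (s : Square) (u w : List (Fin 8)) :
    walkEnd v s (u ++ w) = walkEnd v (walkEnd v s u) w := by
  simp [walkEnd, add_assoc]

theorem walkEnd_cons (s : Square) (k : Fin 8) (w : List (Fin 8)) :
    walkEnd v s (k :: w) = walkEnd v (s + v k) w := by
  simp [walkEnd, add_assoc]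

theorem stepList_append (s : Square) (u w : List (Fin 8)) :
    stepList v s (u ++ w) = stepList v s u ++ stepList v (walkEnd v s u) w := by
  induction u generalizing s with
  | nil => simp [stepList, walkEnd]
  | cons k u ih => simp [stepList, ih, walkEnd_cons]

theorem walkList_append_cons (s : Square) (u w : List (Fin 8)) (k : Fin 8) :
    walkList v s (u ++ k :: w) = walkList v s u ++ walkList v (walkEnd v s u + v k) w := by
  simp [walkList, stepList_append, stepList, walkEnd_append, walkEnd_cons]

theorem stepList_append_singleton (s : Square) (w : List (Fin 8)) (k : Fin 8) :
    stepList v s (w ++ [k]) = walkList v s w := by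
  simp [walkList, stepList_append, stepList]

theorem walkList_cons (s : Square) (k : Fin 8) (w : List (Fin 8)) :
    walkList v s (k :: w) = s :: walkList v (s + v k) w := by
  simp [walkList, stepList, walkEnd_cons]

theorem walkEnd_add (s d : Square) (w : List (Fin 8)) :
    walkEnd v (s + d) w = walkEnd v s w + d := by
  simp only [walkEnd]
  abel

theorem walkList_map_add (s d : Square) (w : List (Fin 8)) :
    (walkList v s w).map (fun x => x + d) = walkList v (s + d) w := by
  induction w generalizing s with
  | nil => simp [walkList, stepList, walkEnd]
  | cons k w ih => rw [walkList_cons, walkList_cons, List.map_cons, ih, add_right_comm]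

variable {v}

theorem reverseWord_cons (k : Fin 8) (w : List (Fin 8)) :
    reverseWord (k :: w) = reverseWord w ++ [k + 4] := by simp [reverseWord]

theorem walkEnd_reverseWord (hv : ∀ k, v (k + 4) = -v k) (s : Square) (w : List (Fin 8)) :
    walkEnd v (walkEnd v s w) (reverseWord w) = s := by
  induction w generalizing s with
  | nil => simp [walkEnd, reverseWord]
  | cons k w ih =>
    rw [reverseWord_cons, walkEnd_append, walkEnd_cons v s, ih]
    simp [walkEnd, hv]

theorem walkList_reverse (hv : ∀ k, v (k + 4) = -v k) (s : Square) (w : List (Fin 8)) :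
    (walkList v s w).reverse = walkList v (walkEnd v s w) (reverseWord w) := by
  induction w generalizing s with
  | nil => simp [walkList, stepList, walkEnd, reverseWord]
  | cons k w ih =>
    rw [walkList_cons, List.reverse_cons, ih, reverseWord_cons, walkList_append_cons,
      walkEnd_cons, walkEnd_reverseWord hv]
    simp [walkList, stepList, walkEnd, hv]

theorem length_stepList (s : Square) (w : List (Fin 8)) :
    (stepList v s w).length = w.length := by
  induction w generalizing s with
  | nil => rfl
  | cons k w ih => simp [stepList, ih]

theorem getElem_stepList (s : Square) (w : List (Fin 8)) {k : ℕ}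
    (hk : k < (stepList v s w).length) :
    (stepList v s w)[k] = walkEnd v s (w.take k) := by
  induction w generalizing s k with
  | nil => simp [stepList] at hk
  | cons j w ih =>
    cases k with
    | zero => simp [stepList, walkEnd]
    | succ k => simp [stepList, ih, walkEnd_cons]

/-- A closed walk follows its word. -/
theorem follows_stepList {s : Square} {w : List (Fin 8)} (hw : w ≠ [])
    (h : walkEnd v s w = s) : Follows v (stepList v s w) w := by
  have hp := List.length_pos_iff.2 hw
  refine ⟨(length_stepList s w).symm, fun k => ?_⟩
  have hk : k % w.length < w.length := Nat.mod_lt _ hp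
  have e : walkEnd v s (w.take (k % w.length + 1)) =
      walkEnd v s (w.take (k % w.length)) + v (cyc w k) := by
    rw [List.take_succ_eq_append_getElem hk, walkEnd_append, ← cyc_mod, cyc_of_lt hk]
    simp [walkEnd]
  have e1 : cyc (stepList v s w) k = walkEnd v s (w.take (k % w.length)) := by
    rw [← cyc_mod, length_stepList, cyc_of_lt (by rwa [length_stepList]), getElem_stepList]
  rw [e1, ← e]
  rcases Nat.lt_or_ge (k % w.length + 1) w.length with hlt | hge
  · rw [cyc_congr (k := k % w.length + 1) (by simp [length_stepList]),
      cyc_of_lt (by rwa [length_stepList]), getElem_stepList]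
  · have hl : k % w.length + 1 = w.length := by omega
    rw [hl, List.take_length, h,
      cyc_congr (j := k + 1) (k := 0) (by
        rw [length_stepList, ← Nat.mod_add_mod, hl]
        simp),
      cyc_of_lt (by rwa [length_stepList]), getElem_stepList]
    simp [walkEnd]

end Walk

theorem Follows.map {v : Fin 8 → Square} {l : List Square} {w : List (Fin 8)} {f : Fin 8 → Fin 8}
    (h : Follows (fun k => v (f k)) l w) (hl : l ≠ []) : Follows v l (w.map f) := by
  have hw : w ≠ [] := by
    rintro rfl
    exact hl (List.length_eq_zero_iff.1 h.length_eq.symm)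
  exact ⟨by simpa using h.length_eq, fun k => by rw [cyc_map f hw, h.step]⟩

/-! ## Liftings of proper cycles -/

/-- The paths `a i` lead from `s i` to `t i` along the words `U i`, moves with the labels `X i` lead
from each path to the next one, and the cycle that they form is proper within the frame `F`. -/
structure IsProperWalk (v : Fin 8 → Square) (F : ℤ × ℤ) (U : Fin 8 → List (Fin 8))
    (X : Fin 8 → Fin 8) (a : Fin 8 → List Square) (s t : Fin 8 → Square) : Prop where
  path : ∀ i, a i = walkList v (s i) (U i)
  end_eq : ∀ i, walkEnd v (s i) (U i) = t i
  junction : ∀ i, t i + v (X i) = s (i + 1)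
  proper_start : ∀ i, s i + properVector F i = t (i + 5)
  proper_end : ∀ i, t (i + 1) + properVector F i = s (i + 4)

/-- The start of the path in the section `i` of the lift, before translation. -/
def liftStart (t : Letter) (s e : Fin 8 → Square) (i : Fin 8) : Square :=
  match t with
  | .f => if i.val % 2 = 0 then e (i + 5) else s i
  | .g => if i.val % 2 = 0 then s i else e (i + 5)
  | .h => if i.val % 2 = 0 then e (i + 6) else s (i + 7)

/-- The end of the path in the section `i` of the lift, before translation. -/
def liftEnd (t : Letter) (s e : Fin 8 → Square) (i : Fin 8) : Square :=
  match t with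
  | .f => if i.val % 2 = 0 then s (i + 3) else e i
  | .g => if i.val % 2 = 0 then e i else s (i + 3)
  | .h => if i.val % 2 = 0 then s (i + 2) else e (i + 1)

namespace IsProperWalk

variable {v : Fin 8 → Square} {F : ℤ × ℤ} {U : Fin 8 → List (Fin 8)} {X : Fin 8 → Fin 8}
  {a : Fin 8 → List Square} {s e : Fin 8 → Square}

/-- Iterating this prolongs a path backwards by one section at a time, up to the five sections that
`h` needs. -/
theorem append (H : IsProperWalk v F U X a s e) {b : List Square} {W : List (Fin 8)} {x : Square}
    (i : Fin 8) (hb : b = walkList v (s (i + 1)) W) (hx : walkEnd v (s (i + 1)) W = x) :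
    a i ++ b = walkList v (s i) (U i ++ X i :: W) ∧
      walkEnd v (s i) (U i ++ X i :: W) = x := by
  rw [walkList_append_cons, walkEnd_append, walkEnd_cons, H.end_eq, H.junction, hx, H.path, hb]
  exact ⟨rfl, rfl⟩

theorem liftPathsAux_eq (H : IsProperWalk v F U X a s e) (hv : ∀ k, v (k + 4) = -v k)
    (t : Letter) (i : Fin 8) :
    liftPathsAux t a i = walkList v (liftStart t s e i) (nextWord t U X i) ∧
      walkEnd v (liftStart t s e i) (nextWord t U X i) = liftEnd t s e i := by
  have rev : ∀ {b W x y}, b = walkList v x W ∧ walkEnd v x W = y →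
      b.reverse = walkList v y (reverseWord W) ∧ walkEnd v y (reverseWord W) = x := by
    rintro b W x y ⟨rfl, rfl⟩
    exact ⟨walkList_reverse hv _ _, walkEnd_reverseWord hv _ _⟩
  have h1 : ∀ i, a i = walkList v (s i) (U i) ∧ walkEnd v (s i) (U i) = e i := fun i =>
    ⟨H.path i, H.end_eq i⟩
  have h2 := fun i => H.append i (h1 (i + 1)).1 (h1 (i + 1)).2
  have h3 := fun i => H.append i (h2 (i + 1)).1 (h2 (i + 1)).2
  have h4 := fun i => H.append i (h3 (i + 1)).1 (h3 (i + 1)).2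
  have h5 := fun i => H.append i (h4 (i + 1)).1 (h4 (i + 1)).2
  have r3 := rev (h3 (i + 3))
  have r5 := rev (h5 (i + 2))
  have r7 := h3 (i + 7)
  simp only [add_assoc, Fin.reduceAdd, add_zero] at r3 r5 r7
  cases t <;> simp only [liftPathsAux, liftStart, liftEnd, nextWord, List.append_assoc] <;>
    split_ifs
  exacts [r3, h1 i, h1 i, r3, r5, r7]

/-- Of properness only the conditions on the ends of the paths are used: they locate the ends of the
reversed blocks, and so show that consecutive lifted paths are still joined by a single old move. -/
theorem lift (H : IsProperWalk v F U X a s e) (hv : ∀ k, v (k + 4) = -v k) (t : Letter) :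
    IsProperWalk v (liftFrame t F) (nextWord t U X) (nextJunction t X) (liftPaths t F a)
      (fun i => liftStart t s e i + liftVector t F i)
      (fun i => liftEnd t s e i + liftVector t F i) := by
  obtain ⟨m, n⟩ := F
  refine ⟨fun i => ?_, fun i => ?_, fun i => ?_, fun i => ?_, fun i => ?_⟩
  · rw [liftPaths, (H.liftPathsAux_eq hv t i).1, walkList_map_add]
  · rw [walkEnd_add, (H.liftPathsAux_eq hv t i).2]
  -- At a junction of the lift, properness replaces the end of a reversed block by an end of an
  -- original path; its translation is absorbed by the difference of the lifting vectors, leaving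
  -- one old junction move.
  · have j0 := H.junction i
    have j1 := H.junction (i + 1)
    have j7 := H.junction (i + 7)
    have p1 := H.proper_start (i + 1)
    have p2 := H.proper_start (i + 2)
    have q6 := H.proper_end (i + 6)
    have q7 := H.proper_end (i + 7)
    clear H
    simp only [Prod.ext_iff] at j0 j1 j7 p1 p2 q6 q7 ⊢
    cases t <;> fin_cases i <;>
    simp [liftVector, liftStart, liftEnd, nextJunction, liftLengths, compass,
      properVector, -zsmul_eq_mul] at j0 j1 j7 p1 p2 q6 q7 ⊢ <;> omega
  -- Both sides are translates of the same square of the smaller frame, so this is an identity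
  -- between lifting vectors, independent of the paths.
  · clear H
    rw [Prod.ext_iff]
    cases t <;> fin_cases i <;>
    simp [liftVector, liftStart, liftFrame, liftEnd, liftLengths, compass,
      properVector, -zsmul_eq_mul] <;> omega
  · clear H
    rw [Prod.ext_iff]
    cases t <;> fin_cases i <;>
    simp [liftVector, liftStart, liftFrame, liftEnd, liftLengths, compass,
      properVector, -zsmul_eq_mul] <;> omega
end IsProperWalk

theorem IsProperWalk.liftSeq {v : Fin 8 → Square} {F : ℤ × ℤ}
    {a : Fin 8 → List Square} {s t : Fin 8 → Square}
    (H : IsProperWalk v F (fun _ => []) id a s t) (hv : ∀ k, v (k + 4) = -v k) (e : List Letter) :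
    ∃ s' t', IsProperWalk v (liftFrameSeq e F) (pathWord e) (junctionLabel e)
      (liftPathsSeq e F a) s' t' := by
  induction e with
  | nil => exact ⟨s, t, H⟩
  | cons l e ih =>
    obtain ⟨s', t', H'⟩ := ih
    exact ⟨_, _, H'.lift hv l⟩

/-- The squares of a proper cycle go around its word. -/
theorem IsProperWalk.follows {v : Fin 8 → Square} {F : ℤ × ℤ} {e : List Letter}
    {a : Fin 8 → List Square} {s t : Fin 8 → Square}
    (H : IsProperWalk v F (pathWord e) (junctionLabel e) a s t) :
    Follows v (concatPaths a) (secondWord e) := by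
  have h1 : ∀ i, a i = stepList v (s i) (pathWord e i ++ [junctionLabel e i]) := fun i => by
    rw [stepList_append_singleton, H.path]
  have h2 : ∀ i, walkEnd v (s i) (pathWord e i ++ [junctionLabel e i]) = s (i + 1) := fun i => by
    rw [walkEnd_append, H.end_eq, ← H.junction]
    simp [walkEnd]
  have hw : secondWord e = (List.map (fun i => pathWord e i ++ [junctionLabel e i])
      [0, 1, 2, 3, 4, 5, 6, 7]).flatten := rfl
  have ha : concatPaths a = (List.map a [0, 1, 2, 3, 4, 5, 6, 7]).flatten := rfl
  have h3 : concatPaths a = stepList v (s 0) (secondWord e) := by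
    rw [hw, ha]
    simp only [List.map_cons, List.map_nil, List.flatten_cons, List.flatten_nil, List.append_nil,
      stepList_append v (s _) (pathWord e _ ++ [_]), h1, h2, Fin.reduceAdd]
  rw [h3]
  refine follows_stepList (by simp [hw]) ?_
  rw [hw]
  simp only [List.map_cons, List.map_nil, List.flatten_cons, List.flatten_nil, List.append_nil,
    walkEnd_append v (s _) (pathWord e _ ++ [_]), h2, Fin.reduceAdd]

/-! ## The squares of the liftings of a proper cycle -/

/-- The paths `a i` lie in the sections `F_i` and visit the squares of `S` once each. -/
structure IsSectioned (F : ℤ × ℤ) (a : Fin 8 → List Square) (S : Set Square) : Prop where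
  within : ∀ i, ∀ x ∈ a i, x ∈ frameSection F i
  nodup : ∀ i, (a i).Nodup
  mem_iff : ∀ x, x ∈ S ↔ ∃ i, x ∈ a i

namespace IsSectioned

variable {F : ℤ × ℤ} {a : Fin 8 → List Square} {S : Set Square}

theorem nodup_flatMap (H : IsSectioned F a S) (hF : F.1 < F.2) {l : List (Fin 8)}
    (hl : l.Nodup) : (l.flatMap a).Nodup := by
  rw [List.nodup_flatMap]
  refine ⟨fun i _ => H.nodup i, hl.imp ?_⟩
  intro i j hij x hx hx'
  exact hij (frameSection_injective hF (H.within i x hx) (H.within j x hx'))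

theorem concatPaths_eq (a : Fin 8 → List Square) :
    concatPaths a = [0, 1, 2, 3, 4, 5, 6, 7].flatMap a := by
  rw [List.flatMap_def]
  rfl

theorem nodup_concatPaths (H : IsSectioned F a S) (hF : F.1 < F.2) : (concatPaths a).Nodup := by
  rw [concatPaths_eq]
  exact H.nodup_flatMap hF (by decide)

theorem mem_concatPaths {x : Square} : x ∈ concatPaths a ↔ ∃ i, x ∈ a i := by
  have : ∀ i : Fin 8, i ∈ [(0 : Fin 8), 1, 2, 3, 4, 5, 6, 7] := by decide
  simp only [concatPaths_eq, List.mem_flatMap, this, true_and]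

/-- The sections glued into the path `b^i` are exactly those whose squares remain in section `i`
after translation; this ties the lifting of paths to the lifting of square sets. -/
theorem exists_perm_liftPathsAux (t : Letter) (a : Fin 8 → List Square) (i : Fin 8) :
    ∃ l : List (Fin 8), l.Nodup ∧ (∀ j, j ∈ l ↔ i ∈ (liftTypePos t j).map Prod.fst) ∧
      (liftPathsAux t a i).Perm (l.flatMap a) := by
  cases t
  · by_cases hi : i.val % 2 = 0
    · refine ⟨[i + 3, i + 4, i + 5], by revert i; decide, by revert i; decide, ?_⟩
      simp only [liftPathsAux, if_pos hi]
      refine (List.reverse_perm _).trans ?_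
      simp
    · refine ⟨[i], by simp, by revert i; decide, ?_⟩
      simp [liftPathsAux, if_neg hi]
  · by_cases hi : i.val % 2 = 0
    · refine ⟨[i], by simp, by revert i; decide, ?_⟩
      simp [liftPathsAux, if_pos hi]
    · refine ⟨[i + 3, i + 4, i + 5], by revert i; decide, by revert i; decide, ?_⟩
      simp only [liftPathsAux, if_neg hi]
      refine (List.reverse_perm _).trans ?_
      simp
  · by_cases hi : i.val % 2 = 0
    · refine ⟨[i + 2, i + 3, i + 4, i + 5, i + 6], by revert i; decide, by revert i; decide, ?_⟩
      simp only [liftPathsAux, if_pos hi]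
      refine (List.reverse_perm _).trans ?_
      simp
    · refine ⟨[i + 7, i, i + 1], by revert i; decide, by revert i; decide, ?_⟩
      simp [liftPathsAux, if_neg hi]

theorem lift (H : IsSectioned F a S) (h1 : 0 < F.1) (h2 : F.1 < F.2) (t : Letter) :
    IsSectioned (liftFrame t F) (liftPaths t F a) (liftSet t F S) := by
  have hmem : ∀ i x, x ∈ liftPathsAux t a i ↔
      ∃ j, x ∈ a j ∧ i ∈ (liftTypePos t j).map Prod.fst := by
    intro i x
    obtain ⟨l, -, hj, hp⟩ := exists_perm_liftPathsAux t a i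
    rw [hp.mem_iff, List.mem_flatMap]
    refine exists_congr fun j => ?_
    rw [hj, and_comm]
  refine ⟨fun i x hx => ?_, fun i => ?_, fun x => ?_⟩
  · obtain ⟨y, hy, rfl⟩ := List.mem_map.1 hx
    obtain ⟨j, hj, hij⟩ := (hmem i y).1 hy
    exact (add_liftVector_mem_iff t h1 h2 (H.within j y hj) i).2 hij
  · obtain ⟨l, hl, -, hp⟩ := exists_perm_liftPathsAux t a i
    exact (hp.nodup_iff.2 (H.nodup_flatMap h2 hl)).map (add_left_injective _)
  · rw [mem_liftSet]
    constructor
    · rintro ⟨s, hs, i, rfl, hi⟩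
      obtain ⟨j, hj⟩ := (H.mem_iff s).1 hs
      rw [add_liftVector_mem_iff t h1 h2 (H.within j s hj)] at hi
      exact ⟨i, List.mem_map.2 ⟨s, (hmem i s).2 ⟨j, hj, hi⟩, rfl⟩⟩
    · rintro ⟨i, hx⟩
      obtain ⟨s, hs, rfl⟩ := List.mem_map.1 hx
      obtain ⟨j, hj, hi⟩ := (hmem i s).1 hs
      exact ⟨s, (H.mem_iff s).2 ⟨j, hj⟩, i, rfl,
        (add_liftVector_mem_iff t h1 h2 (H.within j s hj) i).2 hi⟩

theorem liftSeq (H : IsSectioned F a S) (hF : IsSkewBasic F.1 F.2) (e : List Letter) :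
    IsSectioned (liftFrameSeq e F) (liftPathsSeq e F a) (liftSetSeq e F S) := by
  induction e with
  | nil => exact H
  | cons t e ih =>
    have h := isSkewBasic_liftFrameSeq e hF
    exact ih.lift h.pos h.lt t

end IsSectioned

/-! ## Proper cycles over shell cycles -/

/-- The directions, in cyclic order, of the moves of a proper cycle of the `(r, s)`-leaper over the
squares of a shell cycle of the frame to which `o` lifts the `(r, s)`-frame. -/
def originDirection (o : Letter) : Fin 8 → Fin 8 :=
  match o with
  | .h => fun k => k + 2
  | _ => ![1, 4, 3, 6, 5, 0, 7, 2]

theorem originDirection_antipode (o : Letter) (k : Fin 8) :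
    originDirection o (k + 4) = originDirection o k + 4 := by
  cases o <;> revert k <;> decide

/-- The family of the eight squares of a shell cycle, as paths of one square. -/
def shellPaths (F : ℤ × ℤ) (d : Square) (i : Fin 8) : List Square := [shellCenter F i + d]

theorem isSectioned_shellPaths {F : ℤ × ℤ} {d : Square}
    (h : ∀ i, shellCenter F i + d ∈ frameSection F i) :
    IsSectioned F (shellPaths F d) (Set.range fun i => shellCenter F i + d) := by
  refine ⟨fun i x hx => ?_, fun i => List.nodup_singleton _, fun x => ?_⟩
  · rw [List.mem_singleton.1 hx]
    exact h i
  · simp [shellPaths, eq_comm]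

/-- The central width `n - m` is `s - r` for `g` and `r + s` for `h`, while `m = s`. Hence
neighbouring shell centres, such as `(n - m, 0)` and `(m, m)`, differ by a move of the `(r,
s)`-leaper. -/
theorem isProperWalk_shellPaths {o : Letter} (ho : o = .g ∨ o = .h) (r s : ℤ) (d : Square) :
    IsProperWalk (fun k => dirVec r s (originDirection o k)) (liftFrame o (r, s)) (fun _ => []) id
      (shellPaths (liftFrame o (r, s)) d) (fun i => shellCenter (liftFrame o (r, s)) i + d)
      (fun i => shellCenter (liftFrame o (r, s)) i + d) := by
  obtain ⟨x, y⟩ := d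
  refine ⟨fun i => by simp [walkList, stepList, walkEnd, shellPaths],
    fun i => by simp [walkEnd], fun i => ?_, fun i => ?_, fun i => ?_⟩
  all_goals
    rcases ho with rfl | rfl <;> fin_cases i <;>
    simp [shellCenter, liftFrame, compass, originDirection, dirVec, properVector,
      -zsmul_eq_mul] <;> omega

/-- A proper cycle over the squares of a shell cycle consists of paths of one square. -/
theorem IsProperCycle.eq_shellPaths {F : ℤ × ℤ} (hF : F.1 < F.2) {r s : ℤ}
    {a : Fin 8 → List Square} {D : (leaperGraph r s).Subgraph} (h : IsProperCycle F a D)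
    {d : Square} (hd : ∀ i, shellCenter F i + d ∈ frameSection F i)
    (hD : D.verts = Set.range fun i => shellCenter F i + d) : a = shellPaths F d := by
  funext i
  have hmem : ∀ x ∈ a i, x = shellCenter F i + d := by
    intro x hx
    have hx' : x ∈ D.verts := h.cycle.mem_verts.2 (IsSectioned.mem_concatPaths.2 ⟨i, hx⟩)
    rw [hD] at hx'
    obtain ⟨j, rfl⟩ := hx'
    -- Each section contains only one square of the shell cycle, so a path in it cannot visit any
    -- other.
    rw [frameSection_injective hF (hd j) (h.within i _ hx)]
  have hn : (a i).Nodup := by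
    have := h.cycle.nodup
    rw [concatPaths, List.nodup_flatten] at this
    exact this.1 _ (List.mem_ofFn.2 ⟨i, rfl⟩)
  have hne := h.nonempty i
  revert hmem hn hne
  generalize a i = l
  intro hmem hn hne
  match l, hne with
  | [x], _ => rw [hmem x (by simp), shellPaths]
  | x :: y :: l, _ =>
    have e1 := hmem x (by simp)
    have e2 := hmem y (by simp)
    simp [e1, e2] at hn

/-- A canonical second leaper cycle of descent `e` follows the second word of `e`. -/
theorem IsCanonicalSecondCycle.exists_follows {e : List Letter} {o : Letter}
    (ho : o = .g ∨ o = .h) {p q r s : ℤ} {C : (leaperGraph p q).Subgraph}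
    {D : (leaperGraph r s).Subgraph} (h : IsCanonicalSecondCycle e o C D) :
    0 < r ∧ r < s ∧ ∃ l, IsCycleThrough l D ∧
      Follows (fun k => dirVec r s (originDirection o k)) l (secondWord e) := by
  obtain ⟨rest, C₀, hC, hM, hrest, a, D₀, hD₀, hv₀, hD, hv⟩ := h
  obtain ⟨d, hd, hsec⟩ := hC.exists_verts_eq
  have hF : liftFrameSeq (o :: rest) (1, 2) = liftFrame o (r, s) := by
    rw [← hrest]
    rfl
  have hlt := (isSkewBasic_liftFrameSeq (o :: rest) (F := (1, 2)) isSkewBasic_one_two).lt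
  have hd' := hv₀.trans hd
  rw [hF] at hd' hsec hD₀ hD hlt
  have ha := hD₀.eq_shellPaths hlt hsec hd'
  subst ha
  obtain ⟨s', t', H⟩ := (isProperWalk_shellPaths ho r s d).liftSeq
    (fun k => by rw [originDirection_antipode, dirVec_antipode]) e
  exact ⟨hM.pos, hM.lt, _, hD, H.follows⟩

/-! ## Existence -/

theorem exists_isCycleFromShell (e rest : List Letter)
    (h : 0 < shellSize (liftFrameSeq rest (1, 2))) :
    ∃ (C : (leaperGraph (liftFrameSeq e (liftFrameSeq rest (1, 2))).1
        (liftFrameSeq e (liftFrameSeq rest (1, 2))).2).Subgraph)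
      (C₀ : (leaperGraph (liftFrameSeq rest (1, 2)).1 (liftFrameSeq rest (1, 2)).2).Subgraph),
      IsCycleFromShell e rest _ _ C C₀ ∧
      C₀.verts = Set.range fun i => shellCenter (liftFrameSeq rest (1, 2)) i + 0 := by
  have hF := isSkewBasic_liftFrameSeq rest (F := (1, 2)) isSkewBasic_one_two
  have h0 : |2 * (0 : Square).1| < shellSize (liftFrameSeq rest (1, 2)) := by simpa using h
  have h0' : |2 * (0 : Square).2| < shellSize (liftFrameSeq rest (1, 2)) := by simpa using h
  have hs := shellCenter_add_mem hF.lt h0 h0'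
  obtain ⟨l₀, C₀, hl₀, -, hv₀, -⟩ := exists_list_liftSetSeq [] hF hs
  obtain ⟨l, C, hl, -, hv, hb⟩ := exists_list_liftSetSeq e hF hs
  refine ⟨C, C₀, ⟨isSkewBasic_liftFrameSeq e hF, liftFrameSeq_append e rest _, hl.isCycle, hb,
    ⟨hl₀.isCycle, ?_⟩, hv.trans (congrArg _ hv₀.symm)⟩, hv₀⟩
  rw [hv₀]
  rintro _ ⟨i, rfl⟩
  exact mem_shell_iff.2 ⟨i, 0, rfl, h0, h0'⟩

theorem exists_isFundamental (e : List Letter) :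
    ∃ (V : Type) (Φ : DirectionGraph V), IsFundamental e Φ := by
  -- The `(1, 2)`-frame itself has a shell of eight single squares, so no further lifting is needed.
  obtain ⟨C, C₀, hC, -⟩ := exists_isCycleFromShell e [] (by decide)
  obtain ⟨l, hl, hf⟩ := hC.exists_follows
  obtain ⟨V, Φ, hΦ⟩ := exists_directionGraph hC.skewBasic.pos hC.skewBasic.lt hl hf
    (matrixSum_firstWord e)
  exact ⟨V, Φ, _, _, C, ⟨[], C₀, hC⟩, hΦ⟩

theorem exists_cycle_liftPathsSeq {o : Letter} (ho : o = .g ∨ o = .h) {r s : ℤ}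
    (hM : IsSkewBasic r s) {d : Square}
    (hd : ∀ i, shellCenter (liftFrame o (r, s)) i + d ∈ frameSection (liftFrame o (r, s)) i)
    (e : List Letter) :
    ∃ D : (leaperGraph r s).Subgraph,
      IsCycleThrough (concatPaths (liftPathsSeq e (liftFrame o (r, s))
        (shellPaths (liftFrame o (r, s)) d))) D ∧
      D.verts = liftSetSeq e (liftFrame o (r, s))
        (Set.range fun i => shellCenter (liftFrame o (r, s)) i + d) := by
  have hF : IsSkewBasic (liftFrame o (r, s)).1 (liftFrame o (r, s)).2 :=
    isSkewBasic_liftFrame o (F := (r, s)) hM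
  obtain ⟨s', t', H⟩ := (isProperWalk_shellPaths ho r s d).liftSeq
    (fun k => by rw [originDirection_antipode, dirVec_antipode]) e
  have H' := (isSectioned_shellPaths hd).liftSeq hF e
  have hf := H.follows
  have h3 : 3 ≤ (concatPaths (liftPathsSeq e (liftFrame o (r, s))
      (shellPaths (liftFrame o (r, s)) d))).length := by
    rw [← hf.length_eq, secondWord]
    simp [List.ofFn_succ]
    omega
  obtain ⟨D, hD⟩ := exists_isCycleThrough
    (H'.nodup_concatPaths (isSkewBasic_liftFrameSeq e hF).lt) h3
    (fun k => (leaperGraph_adj_iff hM.pos hM.lt).2 ⟨_, hf.step k⟩)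
  refine ⟨D, hD, Set.ext fun x => ?_⟩
  rw [hD.mem_verts, H'.mem_iff, IsSectioned.mem_concatPaths]

/-- The `(1, 2)`-leaper serves for every `e`: the origins `g` and `h` lift its frame to the `(2,
3)`- and `(2, 5)`-frames, whose shells are again eight single squares. -/
theorem exists_isSecondFundamental (e : List Letter) {o : Letter} (ho : o = .g ∨ o = .h) :
    ∃ (V : Type) (Φ : DirectionGraph V), IsSecondFundamental e o Φ := by
  have hsize : 0 < shellSize (liftFrameSeq [o] (1, 2)) := by
    rcases ho with rfl | rfl <;> decide
  obtain ⟨C, C₀, hC, hv₀⟩ := exists_isCycleFromShell e [o] hsize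
  have hsec : ∀ i, shellCenter (liftFrame o (1, 2)) i + 0 ∈ frameSection (liftFrame o (1, 2)) i :=
    shellCenter_add_mem (isSkewBasic_liftFrame o (F := (1, 2)) isSkewBasic_one_two).lt
      (d := 0) hsize hsize
  obtain ⟨D₀, hD₀, hw₀⟩ := exists_cycle_liftPathsSeq ho isSkewBasic_one_two hsec []
  obtain ⟨D, hD, hw⟩ := exists_cycle_liftPathsSeq ho isSkewBasic_one_two hsec e
  have H := isProperWalk_shellPaths ho 1 2 0
  have hcan : IsCanonicalSecondCycle e o C D := by
    refine ⟨[], C₀, hC, isSkewBasic_one_two, rfl, shellPaths (liftFrame o (1, 2)) 0, D₀,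
      ⟨fun i => by simp [shellPaths], (isSectioned_shellPaths hsec).within, hD₀, fun i => ?_⟩,
      hw₀.trans hv₀.symm, hD, ?_⟩
    · have h1 := H.proper_start i
      have h2 := H.proper_end i
      simp only [shellPaths, List.cons_append, List.nil_append, List.map_cons, List.map_nil,
        List.reverse_cons, List.reverse_nil]
      exact congrArg₂ (fun x y => [x, y]) h1 h2
    · rw [hw, hC.lift, hv₀]
      rfl
  obtain ⟨hr, hs, l, hl, hf⟩ := hcan.exists_follows ho
  have h3 := hl.three_le
  obtain ⟨V, Φ, hΦ⟩ := exists_directionGraph hr hs hl (hf.map (by rintro rfl; simp at h3))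
    (matrixSum_secondWord e _ (originDirection_antipode o))
  exact ⟨V, Φ, _, _, _, _, C, D, hcan, hΦ⟩

/-! ## Equivalences -/

theorem IsFundamental.isOfWord {V : Type*} {e : List Letter} {Φ : DirectionGraph V}
    (h : IsFundamental e Φ) : Φ.IsOfWord (firstWord e) ∧
      NoBacktrack ((firstWord e).map fun d => 3 * d + 6) := by
  obtain ⟨p, q, C, ⟨rest, C₀, hC⟩, hΦ⟩ := h
  obtain ⟨l, hl, hf⟩ := hC.exists_follows
  refine ⟨hΦ.isOfWord hC.skewBasic.pos hC.skewBasic.lt hl hf, ?_⟩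
  have h3 := hl.three_le
  -- The map `3 * d + 6` is an involution that commutes with the antipode, so the relabelled word
  -- describes the same cycle once the translations are relabelled too.
  refine Follows.noBacktrack (v := fun k => dirVec p q (3 * k + 6)) (l := l) ?_ ?_ hl.nodup h3
  · refine Follows.map ?_ (by rintro rfl; simp at h3)
    have : ∀ k : Fin 8, 3 * (3 * k + 6) + 6 = k := by decide
    simpa only [this] using hf
  · intro i
    have : ∀ i : Fin 8, 3 * (i + 4) + 6 = 3 * i + 6 + 4 := by decide
    rw [this, dirVec_antipode]

theorem IsSecondFundamental.isOfWord {V : Type*} {e : List Letter} {o : Letter}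
    (ho : o = .g ∨ o = .h) {Φ : DirectionGraph V} (h : IsSecondFundamental e o Φ) :
    Φ.IsOfWord ((secondWord e).map (originDirection o)) ∧ NoBacktrack (secondWord e) := by
  obtain ⟨p, q, r, s, C, D, hD, hΦ⟩ := h
  obtain ⟨hr, hs, l, hl, hf⟩ := hD.exists_follows ho
  have h3 := hl.three_le
  exact ⟨hΦ.isOfWord hr hs hl (hf.map (by rintro rfl; simp at h3)),
    hf.noBacktrack (fun i => by rw [originDirection_antipode, dirVec_antipode]) hl.nodup h3⟩

theorem originDirection_bijective (o : Letter) : Function.Bijective (originDirection o) := by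
  cases o <;> decide

/-- The relabelling from the first to the second fundamental direction cycles. -/
noncomputable def firstRelabelling (o : Letter) : Equiv.Perm (Fin 8) :=
  Equiv.ofBijective (fun d => originDirection o (3 * d + 6))
    ((originDirection_bijective o).comp (by decide : Function.Bijective fun d : Fin 8 => 3 * d + 6))

/-- The direction matrices form the dihedral group of signed permutation matrices. Since `P * P` is
twice the identity, `A ↦ P * A * P⁻¹` is the automorphism that exchanges its axis-parallel and
diagonal reflections, and `P * Q` is itself a signed permutation matrix; the relabelling is their
composite `(P * A * P⁻¹) * (P * Q)`. -/
theorem isEquivalencePerm_firstRelabelling {o : Letter} (ho : o = .g ∨ o = .h) :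
    IsEquivalencePerm (firstRelabelling o) := by
  rcases ho with rfl | rfl
  · refine ⟨!![-1, 1; 1, 1], !![-1 / 2, 1 / 2; -1 / 2, -1 / 2], fun i => ?_⟩
    ext j k
    fin_cases i <;> fin_cases j <;> fin_cases k <;>
      simp [firstRelabelling, originDirection, dirMatrix, Matrix.mul_apply, Matrix.vecMul,
        dotProduct, Fin.sum_univ_two] <;>
      norm_num
  · refine ⟨!![-1, 1; 1, 1], !![1 / 2, 1 / 2; 1 / 2, -1 / 2], fun i => ?_⟩
    ext j k
    fin_cases i <;> fin_cases j <;> fin_cases k <;>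
      simp [firstRelabelling, originDirection, dirMatrix, Matrix.mul_apply, Matrix.vecMul,
        dotProduct, Fin.sum_univ_two] <;>
      norm_num

/-- The relabelling between the second fundamental direction cycles of origins `g` and `h`. -/
noncomputable def secondRelabelling : Equiv.Perm (Fin 8) :=
  (Equiv.ofBijective _ (originDirection_bijective .g)).symm.trans
    (Equiv.ofBijective _ (originDirection_bijective .h))

theorem secondRelabelling_originDirection (k : Fin 8) :
    secondRelabelling (originDirection .g k) = originDirection .h k := by
  have : originDirection .g k = Equiv.ofBijective _ (originDirection_bijective .g) k := rfl
  rw [secondRelabelling, this, Equiv.trans_apply, Equiv.symm_apply_apply]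
  rfl

theorem isEquivalencePerm_secondRelabelling : IsEquivalencePerm secondRelabelling := by
  refine ⟨!![-1, 0; 0, -1], !![1, 0; 0, -1], fun i => ?_⟩
  obtain ⟨k, rfl⟩ := (originDirection_bijective .g).2 i
  rw [secondRelabelling_originDirection]
  ext a b
  fin_cases k <;> fin_cases a <;> fin_cases b <;>
    simp [originDirection, dirMatrix, Matrix.mul_apply, Matrix.vecMul, dotProduct,
      Fin.sum_univ_two]

/-- The relabelling first passes to the labels in which the two words are rotations of each other,
then reads them as moves of the second leaper. -/
theorem IsFundamental.equivalent {V W : Type*} {e : List Letter} {o : Letter}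
    (ho : o = .g ∨ o = .h) {Φ : DirectionGraph V} {Ψ : DirectionGraph W}
    (h : IsFundamental (flip e) Φ) (h' : IsSecondFundamental e o Ψ) : Φ.Equivalent Ψ := by
  obtain ⟨hw, hn⟩ := h.isOfWord
  obtain ⟨hw', hn'⟩ := h'.isOfWord ho
  refine hw.equivalent hw' (firstRelabelling o) (isEquivalencePerm_firstRelabelling ho) ?_ ?_
  · intro i
    have : ∀ i : Fin 8, 3 * (i + 4) + 6 = 3 * i + 6 + 4 := by decide
    simp only [firstRelabelling, Equiv.ofBijective_apply, this, originDirection_antipode]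
  · have := (isRotated_words e hn hn').map (originDirection o)
    rwa [List.map_map] at this

/-- Both graphs carry the same word `secondWord e`, read through two different origin labellings, so
no rotation is involved. -/
theorem IsSecondFundamental.equivalent {V W : Type*} {e : List Letter}
    {Φ : DirectionGraph V} {Ψ : DirectionGraph W}
    (h : IsSecondFundamental e .g Φ) (h' : IsSecondFundamental e .h Ψ) : Φ.Equivalent Ψ := by
  refine (h.isOfWord (.inl rfl)).1.equivalent (h'.isOfWord (.inr rfl)).1 secondRelabelling
    isEquivalencePerm_secondRelabelling ?_ ?_
  · intro i
    obtain ⟨k, rfl⟩ := (originDirection_bijective .g).2 i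
    rw [← originDirection_antipode, secondRelabelling_originDirection,
      secondRelabelling_originDirection, originDirection_antipode]
  · rw [List.map_map]
    have : secondRelabelling ∘ originDirection .g = originDirection .h :=
      funext secondRelabelling_originDirection
    rw [this]
end Leaper

/-- If the strings `e'` and `e''` are flips of each other, then the fundamental direction cycle of
descent `e'` and the second fundamental direction cycles of descent `e''` and origins `g` and `h`
exist, and they are equivalent, whichever cycles they are extracted from. -/
theorem mainTheorem6 (e' e'' : List Leaper.Letter) (hflip : e' = Leaper.flip e'') :
    (∃ (V : Type) (Φ : Leaper.DirectionGraph V), Leaper.IsFundamental e' Φ) ∧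
    (∃ (V : Type) (Φ : Leaper.DirectionGraph V), Leaper.IsSecondFundamental e'' .g Φ) ∧
    (∃ (V : Type) (Φ : Leaper.DirectionGraph V), Leaper.IsSecondFundamental e'' .h Φ) ∧
    ∀ {V V₁ V₂ : Type*} (Φ : Leaper.DirectionGraph V)
      (Φg : Leaper.DirectionGraph V₁) (Φh : Leaper.DirectionGraph V₂),
      Leaper.IsFundamental e' Φ →
      Leaper.IsSecondFundamental e'' .g Φg →
      Leaper.IsSecondFundamental e'' .h Φh →
      Φ.Equivalent Φg ∧ Φ.Equivalent Φh ∧ Φg.Equivalent Φh := by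
  subst hflip
  refine ⟨Leaper.exists_isFundamental _, Leaper.exists_isSecondFundamental _ (.inl rfl),
    Leaper.exists_isSecondFundamental _ (.inr rfl), ?_⟩
  intro V V₁ V₂ Φ Φg Φh h hg hh
  exact ⟨h.equivalent (.inl rfl) hg, h.equivalent (.inr rfl) hh, hg.equivalent hh⟩
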